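/- Let $\mathcal V$ be a locally presentable symmetric monoidal closed category with unit $I$ and internal hom $[-,-]$ (so $[X,-]$ is right adjoint to $X\otimes -$). Let $\mathbf{Mon}(\mathcal V)$ and $\mathbf{Comon}(\mathcal V)$ be the symmetric monoidal categories of monoids and of comonoids in $\mathcal V$, with tensor product and symmetry lifted from $\mathcal V$. The internal hom carries the canonical maps $$\chi\colon [X,Y]\otimes[X',Y']\to[X\otimes X',Y\otimes Y'],\qquad \chi_0\colon I\to[I,I],$$ the transposes of $(X\otimes X')\otimes([X,Y]\otimes[X',Y'])\cong (X\otimes[X,Y])\otimes(X'\otimes[X',Y'])\xrightarrow{\mathrm{ev}\otimes\mathrm{ev}}Y\otimes Y'$ and of $I\otimes I\cong I$. For a comonoid $(C,\Delta,\varepsilon)$ and a monoid $(B,\mu,\iota)$, the object $[C,B]$ is the convolution monoid with multiplication $[\Delta,\mu]\circ\chi$ and unit $[\varepsilon,\iota]\circ\chi_0$; this gives a functor $[-,-]\colon\mathbf{Comon}(\mathcal V)^{\mathrm{op}}\times\mathbf{Mon}(\mathcal V)\to\mathbf{Mon}(\mathcal V)$. A \emph{Sweedler hom} is a functor $P\colon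 \mathbf{Mon}(\mathcal V)^{\mathrm{op}}\times\mathbf{Mon}(\mathcal V)\to\mathbf{Comon}(\mathcal V)$ together with bijections $$\mathbf{Mon}(\mathcal V)(A,[C,B])\cong\mathbf{Comon}(\mathcal V)(C,P(A,B))$$ natural in $A$, $B$ and $C$; write $\eta_{A,B}\colon A\to[P(A,B),B]$ for the morphism corresponding to $1_{P(A,B)}$. Then a Sweedler hom exists, and every Sweedler hom $P$ is a braided (lax) monoidal functor: it has a lax monoidal structure, compatible with the braidings, with structure maps $$\psi\colon P(A,B)\otimes P(A',B')\to P(A\otimes A',B\otimes B'),\qquad \psi_0\colon I\to P(I,I),$$ which is the unique lax monoidal structure on $P$ satisfying $$[\psi,1]\circ\eta_{A\otimes A',B\otimes B'}=\chi\circ(\eta_{A,B}\otimes\eta_{A',B'}),\qquad [\psi_0,1]\circ\eta_{I,I}=\chi_0 .$$ Moreover $\psi_0\colon I\to P(I,I)$ is an isomorphism. -/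

import Mathlib

open CategoryTheory MonoidalCategory Opposite
open scoped MonObj ComonObj CategoryTheory.Prod

universe v u v₁ u₁ v₂ u₂

/-! ### Braidings on a product of categories and on comonoids -/

/-- The componentwise braiding on a product of two braided monoidal categories. -/
instance prodBraidedCategory (C : Type u₁) [Category.{v₁} C] [MonoidalCategory C]
    [BraidedCategory C] (D : Type u₂) [Category.{v₂} D] [MonoidalCategory D]
    [BraidedCategory D] : BraidedCategory (C × D) where
  braiding X Y := (β_ X.1 Y.1).prod (β_ X.2 Y.2)

section ComonBraiding

variable {V : Type u} [Category.{v} V] [MonoidalCategory V] [SymmetricCategory V]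

theorem braiding_tensorMu (X Y Z W : V) :
    (β_ (X ⊗ Y) (Z ⊗ W)).hom ≫ tensorμ Z W X Y =
      tensorμ X Y Z W ≫ ((β_ X Z).hom ⊗ₘ (β_ Y W).hom) := by
  simp [tensorμ, SymmetricCategory.braiding_swap_eq_inv_braiding X W,
    MonoidalCategory.tensorHom_def]

/-- In a symmetric monoidal category, the symmetry of two comonoids is a comonoid morphism. -/
instance isComonHom_braiding (X Y : V) [ComonObj X] [ComonObj Y] :
    IsComonHom (β_ X Y).hom where
  hom_counit := by
    rw [Comon.tensorObj_counit, Comon.tensorObj_counit,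
      ← BraidedCategory.braiding_naturality_assoc]
    simp
    simp [unitors_equal]
  hom_comul := by
    rw [Comon.tensorObj_comul, Comon.tensorObj_comul,
      ← BraidedCategory.braiding_naturality_assoc, Category.assoc, ← braiding_tensorMu]

/-- The symmetry `X ⊗ Y ≅ Y ⊗ X` of two comonoids. -/
def comonBraiding (X Y : Comon V) : X ⊗ Y ≅ Y ⊗ X :=
  haveI : IsComonHom (M := (X ⊗ Y).X) (N := (Y ⊗ X).X) (β_ X.X Y.X).hom :=
    isComonHom_braiding X.X Y.X
  Comon.mkIso' (M := X ⊗ Y) (N := Y ⊗ X) (β_ X.X Y.X)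

theorem comon_associator_hom (X Y Z : Comon V) :
    (α_ X Y Z).hom.hom = (α_ X.X Y.X Z.X).hom := by
  simp only [Comon.monoidal_associator_hom_hom]
  change 𝟙 (X.X ⊗ Y.X) ▷ Z.X ≫ (α_ X.X Y.X Z.X).hom ≫ X.X ◁ 𝟙 (Y.X ⊗ Z.X) = _
  simp

theorem comon_associator_inv (X Y Z : Comon V) :
    (α_ X Y Z).inv.hom = (α_ X.X Y.X Z.X).inv := by
  simp only [Comon.monoidal_associator_inv_hom]
  change X.X ◁ 𝟙 (Y.X ⊗ Z.X) ≫ (α_ X.X Y.X Z.X).inv ≫ 𝟙 (X.X ⊗ Y.X) ▷ Z.X = _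
  simp

/-- The symmetry of the monoidal category of comonoids, given by the symmetry of `V`. -/
instance comonSymmetricCategory : SymmetricCategory (Comon V) where
  braiding := comonBraiding
  braiding_naturality_right X _ _ f :=
    Comon.ext (BraidedCategory.braiding_naturality_right X.X f.hom)
  braiding_naturality_left f Z :=
    Comon.ext (BraidedCategory.braiding_naturality_left f.hom Z.X)
  hexagon_forward X Y Z := by
    apply Comon.ext
    simp only [Comon.comp_hom', comon_associator_hom, Comon.monoidal_whiskerLeft_hom, Comon.monoidal_whiskerRight_hom]
    exact BraidedCategory.hexagon_forward X.X Y.X Z.X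
  hexagon_reverse X Y Z := by
    apply Comon.ext
    simp only [Comon.comp_hom', comon_associator_inv, Comon.monoidal_whiskerLeft_hom, Comon.monoidal_whiskerRight_hom]
    exact BraidedCategory.hexagon_reverse X.X Y.X Z.X
  symmetry X Y := Comon.ext (SymmetricCategory.symmetry X.X Y.X)

end ComonBraiding

/-! ### The internal hom and convolution monoids -/

namespace Sweedler

variable {V : Type u} [Category.{v} V] [MonoidalCategory V]

/-- The internal hom of morphisms: `[f, g] : [X, Y] ⟶ [X', Y']` for `f : X' ⟶ X`, `g : Y ⟶ Y'`. -/
def ihomMap [MonoidalClosed V] {X X' Y Y' : V} (f : X' ⟶ X) (g : Y ⟶ Y') :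
    (ihom X).obj Y ⟶ (ihom X').obj Y' :=
  (MonoidalClosed.pre f).app Y ≫ (ihom X').map g

theorem uncurry_ihomMap [MonoidalClosed V] {X X' Y Y' Z : V} (h : Z ⟶ (ihom X).obj Y) (f : X' ⟶ X) (g : Y ⟶ Y') :
    MonoidalClosed.uncurry (h ≫ ihomMap f g) = f ▷ Z ≫ MonoidalClosed.uncurry h ≫ g := by
  rw [ihomMap, ← Category.assoc, MonoidalClosed.uncurry_natural_right,
    MonoidalClosed.uncurry_pre_app, Category.assoc]

variable [SymmetricCategory V]

section

variable {C B H K L : V} [ComonObj C] [MonObj B]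

theorem star_one_left (e : C ⊗ H ⟶ B) :
    Δ[C] ▷ (𝟙_ V ⊗ H) ≫ tensorμ C C (𝟙_ V) H ≫ ((ρ_ C).hom ≫ ε[C] ≫ η[B] ⊗ₘ e) ≫ μ[B] =
      C ◁ (λ_ H).hom ≫ e := by
  have h0 : tensorμ (𝟙_ V) C (𝟙_ V) H ≫ (λ_ (𝟙_ V)).hom ▷ (C ⊗ H) =
      ((λ_ C).hom ⊗ₘ (λ_ H).hom) ≫ (λ_ (C ⊗ H)).inv := by
    rw [leftUnitor_monoidal]; simp
  have h1 : ((ρ_ C).hom ≫ ε[C] ≫ η[B] ⊗ₘ e) ≫ μ[B] =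
      (ε[C] ▷ 𝟙_ V ⊗ₘ 𝟙 C ▷ H) ≫ (λ_ (𝟙_ V)).hom ▷ (C ⊗ H) ≫ (λ_ (C ⊗ H)).hom ≫ e := by
    have : (ρ_ C).hom ≫ ε[C] ≫ η[B] = ε[C] ▷ 𝟙_ V ≫ (λ_ (𝟙_ V)).hom ≫ η[B] := by
      rw [unitors_equal, rightUnitor_naturality_assoc]
    have h3 := tensorHom_comp_tensorHom (ε[C] ▷ 𝟙_ V) (𝟙 (C ⊗ H)) ((λ_ (𝟙_ V)).hom ≫ η[B]) e
    have h4 := tensorHom_comp_tensorHom (λ_ (𝟙_ V)).hom (𝟙 (C ⊗ H)) η[B] e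
    rw [Category.id_comp] at h3 h4
    rw [this, ← h3, ← h4, Category.assoc, Category.assoc, MonObj.one_mul_hom, id_whiskerRight,
      tensorHom_id (λ_ (𝟙_ V)).hom]
  have h2 := ComonObj.counit_comul C
  rw [h1, ← tensorμ_natural_left_assoc, reassoc_of% h0, tensorHom_id,
    ← comp_whiskerRight_assoc, h2]
  simp [MonoidalCategory.tensorHom_def]

theorem star_one_right (e : C ⊗ H ⟶ B) :
    Δ[C] ▷ (H ⊗ 𝟙_ V) ≫ tensorμ C C H (𝟙_ V) ≫ (e ⊗ₘ (ρ_ C).hom ≫ ε[C] ≫ η[B]) ≫ μ[B] =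
      C ◁ (ρ_ H).hom ≫ e := by
  have h0 : tensorμ C (𝟙_ V) H (𝟙_ V) ≫ (C ⊗ H) ◁ (λ_ (𝟙_ V)).hom =
      ((ρ_ C).hom ⊗ₘ (ρ_ H).hom) ≫ (ρ_ (C ⊗ H)).inv := by
    rw [rightUnitor_monoidal]; simp
  have h1 : (e ⊗ₘ (ρ_ C).hom ≫ ε[C] ≫ η[B]) ≫ μ[B] =
      (𝟙 C ▷ H ⊗ₘ ε[C] ▷ 𝟙_ V) ≫ (C ⊗ H) ◁ (λ_ (𝟙_ V)).hom ≫ (ρ_ (C ⊗ H)).hom ≫ e := by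
    have : (ρ_ C).hom ≫ ε[C] ≫ η[B] = ε[C] ▷ 𝟙_ V ≫ (λ_ (𝟙_ V)).hom ≫ η[B] := by
      rw [unitors_equal, rightUnitor_naturality_assoc]
    have h3 := tensorHom_comp_tensorHom (𝟙 (C ⊗ H)) (ε[C] ▷ 𝟙_ V) e ((λ_ (𝟙_ V)).hom ≫ η[B])
    have h4 := tensorHom_comp_tensorHom (𝟙 (C ⊗ H)) (λ_ (𝟙_ V)).hom e η[B]
    rw [Category.id_comp] at h3 h4
    rw [this, ← h3, ← h4, Category.assoc, Category.assoc, MonObj.mul_one_hom, id_whiskerRight,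
      id_tensorHom _ (λ_ (𝟙_ V)).hom]
  have h2 := ComonObj.comul_counit C
  rw [h1, ← tensorμ_natural_left_assoc, reassoc_of% h0, id_tensorHom,
    ← comp_whiskerRight_assoc, h2]
  simp [MonoidalCategory.tensorHom_def]

theorem star_assoc (e : C ⊗ H ⟶ B) (f : C ⊗ K ⟶ B) (g : C ⊗ L ⟶ B) :
    Δ[C] ▷ ((H ⊗ K) ⊗ L) ≫ tensorμ C C (H ⊗ K) L ≫
        ((Δ[C] ▷ (H ⊗ K) ≫ tensorμ C C H K ≫ (e ⊗ₘ f) ≫ μ[B]) ⊗ₘ g) ≫ μ[B] =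
      C ◁ (α_ H K L).hom ≫ Δ[C] ▷ (H ⊗ (K ⊗ L)) ≫ tensorμ C C H (K ⊗ L) ≫
        (e ⊗ₘ (Δ[C] ▷ (K ⊗ L) ≫ tensorμ C C K L ≫ (f ⊗ₘ g) ≫ μ[B])) ≫ μ[B] := by
  have h1 : ((Δ[C] ▷ (H ⊗ K) ≫ tensorμ C C H K ≫ (e ⊗ₘ f) ≫ μ[B]) ⊗ₘ g) ≫ μ[B] =
      (Δ[C] ▷ (H ⊗ K) ⊗ₘ 𝟙 C ▷ L) ≫ tensorμ C C H K ▷ (C ⊗ L) ≫ ((e ⊗ₘ f) ⊗ₘ g) ≫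
        (μ[B] ▷ B) ≫ μ[B] := by
    have h3 := tensorHom_comp_tensorHom (Δ[C] ▷ (H ⊗ K)) (𝟙 (C ⊗ L))
      (tensorμ C C H K ≫ (e ⊗ₘ f) ≫ μ[B]) g
    have h4 := tensorHom_comp_tensorHom (tensorμ C C H K) (𝟙 (C ⊗ L)) ((e ⊗ₘ f) ≫ μ[B]) g
    have h5 := tensorHom_comp_tensorHom (e ⊗ₘ f) g μ[B] (𝟙 B)
    rw [Category.id_comp] at h3 h4
    rw [Category.comp_id] at h5
    rw [← h3, ← h4, ← h5, id_whiskerRight, tensorHom_id (tensorμ C C H K), tensorHom_id μ[B],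
      Category.assoc, Category.assoc, Category.assoc]
  have h2 : (e ⊗ₘ (Δ[C] ▷ (K ⊗ L) ≫ tensorμ C C K L ≫ (f ⊗ₘ g) ≫ μ[B])) ≫ μ[B] =
      (𝟙 C ▷ H ⊗ₘ Δ[C] ▷ (K ⊗ L)) ≫ (C ⊗ H) ◁ tensorμ C C K L ≫ (e ⊗ₘ (f ⊗ₘ g)) ≫
        (B ◁ μ[B]) ≫ μ[B] := by
    have h3 := tensorHom_comp_tensorHom (𝟙 (C ⊗ H)) (Δ[C] ▷ (K ⊗ L)) e
      (tensorμ C C K L ≫ (f ⊗ₘ g) ≫ μ[B])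
    have h4 := tensorHom_comp_tensorHom (𝟙 (C ⊗ H)) (tensorμ C C K L) e ((f ⊗ₘ g) ≫ μ[B])
    have h5 := tensorHom_comp_tensorHom e (f ⊗ₘ g) (𝟙 B) μ[B]
    rw [Category.id_comp] at h3 h4
    rw [Category.comp_id] at h5
    rw [← h3, ← h4, ← h5, id_whiskerRight, id_tensorHom _ (tensorμ C C K L),
      id_tensorHom _ μ[B], Category.assoc, Category.assoc, Category.assoc]
  have h3 : tensorμ (C ⊗ C) C (H ⊗ K) L ≫ tensorμ C C H K ▷ (C ⊗ L) =
      ((α_ C C C).hom ⊗ₘ (α_ H K L).hom) ≫ tensorμ C (C ⊗ C) H (K ⊗ L) ≫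
        ((C ⊗ H) ◁ tensorμ C C K L) ≫ (α_ _ _ _).inv := by
    have := associator_monoidal C C C H K L
    rw [← Category.assoc, ← Iso.eq_comp_inv] at this
    simpa using this
  rw [h1, h2, ← tensorμ_natural_left_assoc, ← tensorμ_natural_left_assoc, reassoc_of% h3,
    MonObj.mul_assoc, associator_naturality_assoc, Iso.inv_hom_id_assoc, tensorHom_id,
    id_tensorHom, MonoidalCategory.tensorHom_def, Category.assoc, ← comp_whiskerRight_assoc,
    ← comp_whiskerRight_assoc, Category.assoc, ← ComonObj.comul_assoc, whisker_exchange_assoc,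
    comp_whiskerRight_assoc, whisker_exchange_assoc]

theorem star_natural {C' B' : V} [ComonObj C'] [MonObj B'] (f : C' ⟶ C) (g : B ⟶ B')
    [IsComonHom f] [IsMonHom g] (e : C ⊗ H ⟶ B) (e' : C ⊗ K ⟶ B) :
  f ▷ (H ⊗ K) ≫ (Δ[C] ▷ (H ⊗ K) ≫ tensorμ C C H K ≫ (e ⊗ₘ e') ≫ μ[B]) ≫ g =
    Δ[C'] ▷ (H ⊗ K) ≫ tensorμ C' C' H K ≫ (f ▷ H ≫ e ≫ g ⊗ₘ f ▷ K ≫ e' ≫ g) ≫ μ[B'] := by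
  rw [← tensorHom_comp_tensorHom_assoc, ← tensorμ_natural_left_assoc]
  simp only [← comp_whiskerRight_assoc, ← IsComonHom.hom_comul, Category.assoc, IsMonHom.mul_hom,
    tensorHom_comp_tensorHom_assoc]

end

variable [MonoidalClosed V]

/-- The binary structure map `[X, Y] ⊗ [X', Y'] ⟶ [X ⊗ X', Y ⊗ Y']` of the internal hom,
the transpose of
`(X ⊗ X') ⊗ ([X, Y] ⊗ [X', Y']) ≅ (X ⊗ [X, Y]) ⊗ (X' ⊗ [X', Y']) ⟶ Y ⊗ Y'`. -/
def ihomMu (X Y X' Y' : V) :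
    (ihom X).obj Y ⊗ (ihom X').obj Y' ⟶ (ihom (X ⊗ X')).obj (Y ⊗ Y') :=
  MonoidalClosed.curry
    (tensorμ X X' ((ihom X).obj Y) ((ihom X').obj Y') ≫
      ((ihom.ev X).app Y ⊗ₘ (ihom.ev X').app Y'))

variable (V) in
/-- The unit structure map `I ⟶ [I, I]` of the internal hom, the transpose of `I ⊗ I ≅ I`. -/
def ihomEps : 𝟙_ V ⟶ (ihom (𝟙_ V)).obj (𝟙_ V) :=
  MonoidalClosed.curry (λ_ (𝟙_ V)).hom

theorem uncurry_ihomMu {X Y X' Y' Z Z' : V} (h : Z ⟶ (ihom X).obj Y)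
    (h' : Z' ⟶ (ihom X').obj Y') :
    MonoidalClosed.uncurry ((h ⊗ₘ h') ≫ ihomMu X Y X' Y') =
      tensorμ X X' Z Z' ≫ (MonoidalClosed.uncurry h ⊗ₘ MonoidalClosed.uncurry h') := by
  rw [MonoidalClosed.uncurry_natural_left, ihomMu, MonoidalClosed.uncurry_curry,
    tensorμ_natural_right_assoc, MonoidalClosed.uncurry_eq, MonoidalClosed.uncurry_eq,
    tensorHom_comp_tensorHom]

theorem uncurry_ihomMu_ihomMap {X Y X' Y' Z Z' C B : V} (h : Z ⟶ (ihom X).obj Y)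
    (h' : Z' ⟶ (ihom X').obj Y') (f : C ⟶ X ⊗ X') (g : Y ⊗ Y' ⟶ B) :
    MonoidalClosed.uncurry ((h ⊗ₘ h') ≫ ihomMu X Y X' Y' ≫ ihomMap f g) =
      f ▷ (Z ⊗ Z') ≫ tensorμ X X' Z Z' ≫
        (MonoidalClosed.uncurry h ⊗ₘ MonoidalClosed.uncurry h') ≫ g := by
  rw [← Category.assoc, uncurry_ihomMap, uncurry_ihomMu, Category.assoc]

theorem uncurry_ihomEps_ihomMap {C B : V} (f : C ⟶ 𝟙_ V) (g : 𝟙_ V ⟶ B) :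
    MonoidalClosed.uncurry (ihomEps V ≫ ihomMap f g) = (ρ_ C).hom ≫ f ≫ g := by
  rw [uncurry_ihomMap, ihomEps, MonoidalClosed.uncurry_curry, unitors_equal,
    rightUnitor_naturality_assoc]

theorem uncurry_ihomMu_ihomMap' {X Y X' Y' C B : V} (f : C ⟶ X ⊗ X') (g : Y ⊗ Y' ⟶ B) :
    MonoidalClosed.uncurry (ihomMu X Y X' Y' ≫ ihomMap f g) =
      f ▷ ((ihom X).obj Y ⊗ (ihom X').obj Y') ≫ tensorμ X X' ((ihom X).obj Y) ((ihom X').obj Y') ≫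
        ((ihom.ev X).app Y ⊗ₘ (ihom.ev X').app Y') ≫ g := by
  rw [uncurry_ihomMap, ihomMu, MonoidalClosed.uncurry_curry, Category.assoc]

/-- The convolution monoid `[C, B]` of a comonoid `C` and a monoid `B`: its multiplication is
`[C, B] ⊗ [C, B] ⟶ [C ⊗ C, B ⊗ B] ⟶ [C, B]`, its unit is `I ⟶ [I, I] ⟶ [C, B]`. -/
instance convMonObj (C B : V) [ComonObj C] [MonObj B] : MonObj ((ihom C).obj B) where
  one := ihomEps V ≫ ihomMap ε[C] η[B]
  mul := ihomMu C B C B ≫ ihomMap Δ[C] μ[B]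
  one_mul := by
    apply MonoidalClosed.uncurry_injective
    rw [← tensorHom_id, uncurry_ihomMu_ihomMap, uncurry_ihomEps_ihomMap,
      MonoidalClosed.uncurry_id_eq_ev, MonoidalClosed.uncurry_eq]
    exact star_one_left _
  mul_one := by
    apply MonoidalClosed.uncurry_injective
    rw [← id_tensorHom, uncurry_ihomMu_ihomMap, uncurry_ihomEps_ihomMap,
      MonoidalClosed.uncurry_id_eq_ev, MonoidalClosed.uncurry_eq]
    exact star_one_right _
  mul_assoc := by
    apply MonoidalClosed.uncurry_injective
    rw [← tensorHom_id, uncurry_ihomMu_ihomMap, uncurry_ihomMu_ihomMap',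
      MonoidalClosed.uncurry_id_eq_ev, MonoidalClosed.uncurry_natural_left,
      ← id_tensorHom ((ihom C).obj B), uncurry_ihomMu_ihomMap, uncurry_ihomMu_ihomMap',
      MonoidalClosed.uncurry_id_eq_ev]
    exact star_assoc _ _ _

theorem conv_one (C B : V) [ComonObj C] [MonObj B] :
    η[(ihom C).obj B] = ihomEps V ≫ ihomMap ε[C] η[B] := rfl

theorem conv_mul (C B : V) [ComonObj C] [MonObj B] :
    μ[(ihom C).obj B] = ihomMu C B C B ≫ ihomMap Δ[C] μ[B] := rfl

instance ihomMap_isMonHom {C C' B B' : V} [ComonObj C] [ComonObj C'] [MonObj B] [MonObj B']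
    (f : C' ⟶ C) (g : B ⟶ B') [IsComonHom f] [IsMonHom g] : IsMonHom (ihomMap f g) where
  one_hom := by
    apply MonoidalClosed.uncurry_injective
    rw [conv_one, conv_one, uncurry_ihomMap, uncurry_ihomEps_ihomMap, uncurry_ihomEps_ihomMap]
    simp
  mul_hom := by
    apply MonoidalClosed.uncurry_injective
    rw [conv_mul, conv_mul, uncurry_ihomMap, uncurry_ihomMu_ihomMap,
      uncurry_ihomMu_ihomMap', ← Category.id_comp (ihomMap f g), uncurry_ihomMap,
      MonoidalClosed.uncurry_id_eq_ev]
    exact star_natural f g _ _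

variable (V) in
/-- The functor `[-, -] : Comon(V)ᵒᵖ × Mon(V) ⥤ Mon(V)` sending `(C, B)` to the convolution
monoid `[C, B]`. -/
def convHom : (Comon V)ᵒᵖ × Mon V ⥤ Mon V where
  obj X := Mon.mk ((ihom X.1.unop.X).obj X.2.X)
  map f := Mon.ofHom (ihomMap f.1.unop.hom f.2.hom)
  map_id X := by
    apply Mon.Hom.ext'
    simp [ihomMap]
  map_comp f g := by
    apply Mon.Hom.ext'
    apply MonoidalClosed.uncurry_injective
    simp [ihomMap]

variable (V) in
/-- A Sweedler hom for `V`: a functor `P : Mon(V)ᵒᵖ × Mon(V) ⥤ Comon(V)` which is a parametrised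
adjoint of the convolution functor, that is, a bijection
`Mon(V)(A, [C, B]) ≃ Comon(V)(C, P(A, B))` natural in `A`, `B` and `C`. -/
structure SweedlerHom where
  /-- The functor `P`; the object `P(A, B)` is the universal measuring comonoid. -/
  P : (Mon V)ᵒᵖ × Mon V ⥤ Comon V
  /-- The bijection `Mon(V)(A, [C, B]) ≃ Comon(V)(C, P(A, B))`. -/
  homEquiv (A B : Mon V) (C : Comon V) :
    (A ⟶ (convHom V).obj (op C, B)) ≃ (C ⟶ P.obj (op A, B))
  homEquiv_naturality {A A' B B' : Mon V} {C C' : Comon V} (a : A' ⟶ A) (b : B ⟶ B')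
    (c : C' ⟶ C) (f : A ⟶ (convHom V).obj (op C, B)) :
    homEquiv A' B' C' (a ≫ f ≫ (convHom V).map (c.op ×ₘ b)) =
      c ≫ homEquiv A B C f ≫ P.map (a.op ×ₘ b)

namespace SweedlerHom

/-- The universal measuring `A ⟶ [P(A, B), B]`, corresponding to the identity of `P(A, B)`. -/
def univ (S : SweedlerHom V) (A B : Mon V) :
    A ⟶ (convHom V).obj (op (S.P.obj (op A, B)), B) :=
  (S.homEquiv A B (S.P.obj (op A, B))).symm (𝟙 _)

/-- A (lax) monoidal structure on `P`, with structure maps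
`μ : P(A, B) ⊗ P(A', B') ⟶ P(A ⊗ A', B ⊗ B')` and `ε : I ⟶ P(I, I)`, is the one induced by the
monoidal structure of the internal hom when
* `A ⊗ A' ⟶ [P(A ⊗ A', B ⊗ B'), B ⊗ B'] ⟶ [P(A, B) ⊗ P(A', B'), B ⊗ B']` (the second map being
  `[μ, 1]`) equals
  `A ⊗ A' ⟶ [P(A, B), B] ⊗ [P(A', B'), B'] ⟶ [P(A, B) ⊗ P(A', B'), B ⊗ B']`, and
* `I ⟶ [P(I, I), I] ⟶ [I, I]` (the second map being `[ε, 1]`) is the canonical `I ⟶ [I, I]`. -/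
structure IsInduced (S : SweedlerHom V) (L : S.P.LaxMonoidal) : Prop where
  mu_univ (A B A' B' : Mon V) :
    (S.univ (A ⊗ A') (B ⊗ B')).hom ≫
        ihomMap (L.μ (op A, B) (op A', B')).hom (𝟙 (B.X ⊗ B'.X)) =
      ((S.univ A B).hom ⊗ₘ (S.univ A' B').hom) ≫
        ihomMu (S.P.obj (op A, B)).X B.X (S.P.obj (op A', B')).X B'.X
  eps_univ :
    (S.univ (𝟙_ (Mon V)) (𝟙_ (Mon V))).hom ≫ ihomMap L.ε.hom (𝟙 (𝟙_ V)) = ihomEps V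

end SweedlerHom

end Sweedler

/-! Existence. For fixed `B` the functor `[-, B]` from `Comon(V)ᵒᵖ` to `Mon(V)` must have a left
adjoint, and the general adjoint functor theorem supplies it. Colimits of comonoids are computed in
`V` and `[-, B]` turns colimits in `V` into limits, so continuity is easy. The solution set comes
from a small dense subcategory of `Comon(V)`: the comonoids whose underlying object is
`κ`-presentable, for an uncountable regular `κ` such that `V` is locally `κ`-presentable.

Density is the hard part. Write a comonoid `C` as a `κ`-filtered colimit of `κ`-presentable objects
`K j`. The comultiplication restricted to `K j` lifts to `K j ⟶ K l ⊗ K l`. Coherence with the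
previous lift and the comonoid axioms hold in the colimit, hence already at a later index
(`Stage.exists_isNext`). Repeating this countably often and taking the sequential colimit gives a
`κ`-presentable comonoid over `C` through which `K j` factors (`Stage.exists_comonObj`). Two such
comonoids that agree on a `κ`-presentable object merge into a third (`exists_merge`), so compatible
families on presentable comonoids over `C` glue uniquely (`existsUnique_desc`).

Lax structure. Morphisms `C ⟶ P(A, B)` are the same as measurings `C ⊗ A ⟶ B`. Measurings can be
tensored (`IsMeasuring.tensor`), which defines `ψ`. A morphism into `P(A, B)` is determined by its
measuring, so each coherence law reduces to an identity between middle-four interchanges `tensorμ`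
in `V`. The two displayed equations prescribe the measurings of `ψ` and `ψ₀`, whence uniqueness.
Finally `I` is initial among monoids, so `P(I, I)` is terminal among comonoids, as is `I`. -/

namespace Sweedler

open Limits

/-! ### Sequential colimits and comonoid structures on them. -/

section SequentialComonoid

variable {V : Type u} [Category.{v} V]

/-- A sequence of `κ`-presentable objects, with `κ` uncountable, has a `κ`-presentable colimit. -/
theorem exists_sequential_colimit [HasColimitsOfSize.{v, v} V] (κ : Cardinal.{v})
    [Fact κ.IsRegular] (hκ : Cardinal.aleph0 < κ) (X : ℕ → V) (f : ∀ n, X n ⟶ X (n + 1))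
    (hX : ∀ n, IsCardinalPresentable (X n) κ) :
    ∃ (L : V) (i : ∀ n, X n ⟶ L), IsCardinalPresentable L κ ∧ (∀ n, f n ≫ i (n + 1) = i n) ∧
      (∀ (Z : V) (g : ∀ n, X n ⟶ Z), (∀ n, f n ≫ g (n + 1) = g n) →
        ∃ d : L ⟶ Z, ∀ n, i n ≫ d = g n) ∧
      (∀ (Z : V) (a b : L ⟶ Z), (∀ n, i n ≫ a = i n ≫ b) → a = b) := by
  have : HasColimitsOfSize.{0, 0} V := hasColimitsOfSizeShrink.{0, 0, v, v} V
  let F := Functor.ofSequence f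
  have hF (n : ℕ) : IsCardinalPresentable (F.obj n) κ := hX n
  refine ⟨colimit F, fun n => colimit.ι F n, ?_, ?_, ?_, ?_⟩
  -- Uncountability of `κ` enters here: a sequence is a `κ`-small diagram.
  · have hc : HasCardinalLT (Arrow ℕ) κ := by
      have : Countable (Arrow ℕ) := by
        have : Function.Injective (fun a : Arrow ℕ => (a.left, a.right)) := by
          rintro ⟨a, b, f⟩ ⟨a', b', f'⟩ h
          obtain ⟨rfl, rfl⟩ : a = a' ∧ b = b' := by simpa using h
          obtain rfl : f = f' := Subsingleton.elim _ _
          rfl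
        exact this.countable
      refine lt_of_le_of_lt (b := Cardinal.lift.{0} Cardinal.aleph0.{v}) ?_ (by simpa using hκ)
      simp
    exact isCardinalPresentable_of_isColimit _ (colimit.isColimit F) κ hc
  · intro n
    have := colimit.w F (homOfLE (Nat.le_add_right n 1))
    rwa [Functor.ofSequence_map_homOfLE_succ] at this
  · intro Z g hg
    let α : F ⟶ (Functor.const ℕ).obj Z := NatTrans.ofSequence g (fun n => by
      rw [Functor.ofSequence_map_homOfLE_succ]; exact (hg n).trans (Category.comp_id _).symm)
    exact ⟨colimit.desc F ⟨Z, α⟩, fun n => colimit.ι_desc _ _⟩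
  · intro Z a b h
    exact colimit.hom_ext h

variable [MonoidalCategory V]

/-- A comonoid structure on the colimit `L` of a sequence `X n` equipped with maps
`X n ⟶ X (n + 1) ⊗ X (n + 1)` which are comonoid comultiplications in the limit. -/
theorem exists_comonObj_sequential {X : ℕ → V} {f : ∀ n, X n ⟶ X (n + 1)} {L : V}
    {i : ∀ n, X n ⟶ L} (hi : ∀ n, f n ≫ i (n + 1) = i n)
    (hdesc : ∀ (Z : V) (g : ∀ n, X n ⟶ Z), (∀ n, f n ≫ g (n + 1) = g n) →
        ∃ d : L ⟶ Z, ∀ n, i n ≫ d = g n)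
    (hext : ∀ (Z : V) (a b : L ⟶ Z), (∀ n, i n ≫ a = i n ≫ b) → a = b)
    (δ : ∀ n, X n ⟶ X (n + 1) ⊗ X (n + 1)) (e : ∀ n, X n ⟶ 𝟙_ V)
    (he : ∀ n, f n ≫ e (n + 1) = e n)
    (coh : ∀ n, δ n ≫ (f (n + 1) ⊗ₘ f (n + 1)) = f n ≫ δ (n + 1))
    (assoc : ∀ n, δ n ≫ (δ (n + 1) ⊗ₘ f (n + 1)) ≫ (α_ _ _ _).hom =
      δ n ≫ (f (n + 1) ⊗ₘ δ (n + 1)))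
    (counit_left : ∀ n, δ n ≫ (e (n + 1) ⊗ₘ f (n + 1)) = f n ≫ f (n + 1) ≫ (λ_ _).inv)
    (counit_right : ∀ n, δ n ≫ (f (n + 1) ⊗ₘ e (n + 1)) = f n ≫ f (n + 1) ≫ (ρ_ _).inv) :
    ∃ _ : ComonObj L, (∀ n, i n ≫ Δ[L] = δ n ≫ (i (n + 1) ⊗ₘ i (n + 1))) ∧
      ∀ n, i n ≫ ε[L] = e n := by
  obtain ⟨d, hd⟩ := hdesc _ (fun n => δ n ≫ (i (n + 1) ⊗ₘ i (n + 1))) (fun n => by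
    rw [← reassoc_of% (coh n), tensorHom_comp_tensorHom, hi])
  obtain ⟨c, hc⟩ := hdesc _ e he
  -- Each `δ` raises the index by one, so an axiom involving two successive maps is compared in `X
  -- (n + 2)`.
  have hi2 (n : ℕ) : f n ≫ f (n + 1) ≫ i (n + 2) = i n := by rw [hi, hi]
  refine ⟨⟨c, d, ?_, ?_, ?_⟩, hd, hc⟩
  · refine hext _ _ _ fun n => ?_
    rw [reassoc_of% (hd n), ← tensorHom_id, tensorHom_comp_tensorHom, hc, Category.comp_id,
      ← Category.comp_id (e (n + 1)), ← hi (n + 1), ← tensorHom_comp_tensorHom,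
      reassoc_of% (counit_left n), id_tensorHom, ← leftUnitor_inv_naturality,
      reassoc_of% (hi2 n)]
  · refine hext _ _ _ fun n => ?_
    rw [reassoc_of% (hd n), ← id_tensorHom, tensorHom_comp_tensorHom, hc, Category.comp_id,
      ← Category.comp_id (e (n + 1)), ← hi (n + 1), ← tensorHom_comp_tensorHom,
      reassoc_of% (counit_right n), tensorHom_id, ← rightUnitor_inv_naturality,
      reassoc_of% (hi2 n)]
  · refine hext _ _ _ fun n => ?_
    rw [reassoc_of% (hd n), reassoc_of% (hd n), ← id_tensorHom, ← tensorHom_id,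
      tensorHom_comp_tensorHom, tensorHom_comp_tensorHom_assoc, hd, Category.comp_id, ← hi (n + 1),
      ← tensorHom_comp_tensorHom, ← tensorHom_comp_tensorHom, Category.assoc,
      ← reassoc_of% (assoc n), associator_naturality]

end SequentialComonoid

section Leg

variable {V : Type*} [Category* V] {J : Type*} [Category* J] {K : J ⥤ V} (c : Cocone K)

/-- The legs of a cocone, as morphisms to `c.pt`. -/
def leg (j : J) : K.obj j ⟶ c.pt := c.ι.app j

variable {c} in
theorem leg_w {j k : J} (u : j ⟶ k) : K.map u ≫ leg c k = leg c j := c.w u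

variable {c} in
theorem leg_w_assoc {j k : J} (u : j ⟶ k) {Z : V} (h : c.pt ⟶ Z) :
    K.map u ≫ leg c k ≫ h = leg c j ≫ h := c.w_assoc u h

end Leg

/-! ### Tensor powers of `κ`-filtered colimits. -/

section FilteredTensor

variable {V : Type u} [Category.{v} V] [MonoidalCategory V] [SymmetricCategory V]
  [MonoidalClosed V]

instance preservesColimitsOfSize_tensorRight (X : V) :
    PreservesColimitsOfSize.{v₁, u₁} (tensorRight X) :=
  preservesColimits_of_natIso (BraidedCategory.tensorLeftIsoTensorRight X)

instance preservesColimit₂_curriedTensor {J₁ J₂ : Type*} [Category* J₁] [Category* J₂]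
    (K₁ : J₁ ⥤ V) (K₂ : J₂ ⥤ V) : PreservesColimit₂ K₁ K₂ (curriedTensor V) :=
  have (X : V) : PreservesColimit K₁ ((curriedTensor V).flip.obj X) :=
    inferInstanceAs (PreservesColimit K₁ (tensorRight X))
  have (X : V) : PreservesColimit K₂ ((curriedTensor V).obj X) :=
    inferInstanceAs (PreservesColimit K₂ (tensorLeft X))
  inferInstance

variable {κ : Cardinal.{v}} [Fact κ.IsRegular] {J : Type v} [SmallCategory J]
  [IsCardinalFiltered J κ] {K : J ⥤ V} {c : Cocone K} (hc : IsColimit c)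
  {X : V} [IsCardinalPresentable X κ]

include hc κ

/-- The tensor product preserves colimits in each variable and filtered categories are sifted, so
`c.pt ⊗ c.pt` is the colimit of the diagonal diagram `K j ⊗ K j`. Presentability of `X` then
applies. -/
theorem exists_lift_tensor (f : X ⟶ c.pt ⊗ c.pt) :
    ∃ (j : J) (g : X ⟶ K.obj j ⊗ K.obj j), g ≫ (leg c j ⊗ₘ leg c j) = f := by
  have := isFiltered_of_isCardinalFiltered J κ
  have : Nonempty J := IsFiltered.nonempty
  have : IsSifted J := ⟨⟩
  exact IsCardinalPresentable.exists_hom_of_isColimit κ (hc.tensor hc) f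

theorem exists_eq_tensor {j : J} (g g' : X ⟶ K.obj j ⊗ K.obj j)
    (h : g ≫ (leg c j ⊗ₘ leg c j) = g' ≫ (leg c j ⊗ₘ leg c j)) :
    ∃ (k : J) (u : j ⟶ k), g ≫ (K.map u ⊗ₘ K.map u) = g' ≫ (K.map u ⊗ₘ K.map u) := by
  have := isFiltered_of_isCardinalFiltered J κ
  have : Nonempty J := IsFiltered.nonempty
  have : IsSifted J := ⟨⟩
  exact IsCardinalPresentable.exists_eq_of_isColimit' κ (hc.tensor hc) g g' h

theorem exists_eq_tensor_tensor {j : J} (g g' : X ⟶ K.obj j ⊗ K.obj j ⊗ K.obj j)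
    (h : g ≫ (leg c j ⊗ₘ leg c j ⊗ₘ leg c j) =
      g' ≫ (leg c j ⊗ₘ leg c j ⊗ₘ leg c j)) :
    ∃ (k : J) (u : j ⟶ k), g ≫ (K.map u ⊗ₘ K.map u ⊗ₘ K.map u) =
      g' ≫ (K.map u ⊗ₘ K.map u ⊗ₘ K.map u) := by
  have := isFiltered_of_isCardinalFiltered J κ
  have : Nonempty J := IsFiltered.nonempty
  have : IsSifted J := ⟨⟩
  exact IsCardinalPresentable.exists_eq_of_isColimit' κ (hc.tensor (hc.tensor hc)) g g' h

end FilteredTensor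

/-! ### Approximating a comonoid by presentable ones. -/

section Stage

theorem exists_common_of_isFiltered {J : Type*} [Category* J] [IsFiltered J] {l : J}
    {P Q : ∀ m : J, (l ⟶ m) → Prop}
    (hP : ∀ {m n : J} (v : l ⟶ m) (w : m ⟶ n), P m v → P n (v ≫ w))
    (hQ : ∀ {m n : J} (v : l ⟶ m) (w : m ⟶ n), Q m v → Q n (v ≫ w))
    (h : ∃ m v, P m v) (h' : ∃ m v, Q m v) : ∃ m v, P m v ∧ Q m v := by
  obtain ⟨m, v, hv⟩ := h
  obtain ⟨n, w, hw⟩ := h'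
  obtain ⟨k, a, b, hab⟩ := IsFiltered.span v w
  exact ⟨k, v ≫ a, hP v a hv, hab ▸ hQ w b hw⟩

variable {V : Type u} [Category.{v} V] [MonoidalCategory V]
  {J : Type v} [SmallCategory J] {K : J ⥤ V} (c : Cocone K) [ComonObj c.pt]

/-- A lift to a diagram `K` with colimit `c.pt` of the comultiplication of `c.pt`,
along the object `K.obj j`. -/
structure Stage (j : J) where
  /-- The index of the target of the lift. -/
  tgt : J
  /-- The transition from the source to the target. -/
  u : j ⟶ tgt
  /-- The lift of the comultiplication. -/
  δ : K.obj j ⟶ K.obj tgt ⊗ K.obj tgt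
  w : δ ≫ (leg c tgt ⊗ₘ leg c tgt) = leg c j ≫ Δ[c.pt]

variable {c}

/-- Composition of a lift of the comultiplication with a further transition. -/
@[simps]
def Stage.extend {j : J} (s : Stage c j) {l : J} (v : s.tgt ⟶ l) : Stage c j where
  tgt := l
  u := s.u ≫ v
  δ := s.δ ≫ (K.map v ⊗ₘ K.map v)
  w := by rw [Category.assoc, tensorHom_comp_tensorHom, leg_w, s.w]

/-- The stage `t` satisfies the axioms of comonoids relatively to the stage `s`. -/
structure Stage.IsNext {j : J} (s : Stage c j) (t : Stage c s.tgt) : Prop where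
  coh : s.δ ≫ (K.map t.u ⊗ₘ K.map t.u) = K.map s.u ≫ t.δ
  assoc : s.δ ≫ (t.δ ⊗ₘ K.map t.u) ≫ (α_ _ _ _).hom = s.δ ≫ (K.map t.u ⊗ₘ t.δ)
  counit_left : s.δ ≫ (leg c s.tgt ≫ ε[c.pt] ⊗ₘ K.map t.u) ≫ (λ_ _).hom =
    K.map s.u ≫ K.map t.u
  counit_right : s.δ ≫ (K.map t.u ⊗ₘ leg c s.tgt ≫ ε[c.pt]) ≫ (ρ_ _).hom =
    K.map s.u ≫ K.map t.u

variable [SymmetricCategory V] [MonoidalClosed V]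
  {κ : Cardinal.{v}} [Fact κ.IsRegular] [IsCardinalFiltered J κ] (hc : IsColimit c)
  [hK : ∀ j, IsCardinalPresentable (K.obj j) κ]

include hc κ hK

/-- The index where the comultiplication lifts need not receive a map from `j`; moving to an upper
bound repairs this. -/
theorem Stage.nonempty (j : J) : Nonempty (Stage c j) := by
  have := isFiltered_of_isCardinalFiltered J κ
  obtain ⟨l, g, hg⟩ := exists_lift_tensor (κ := κ) hc (leg c j ≫ Δ[c.pt])
  refine ⟨⟨IsFiltered.max j l, IsFiltered.leftToMax j l,
    g ≫ (K.map (IsFiltered.rightToMax j l) ⊗ₘ K.map (IsFiltered.rightToMax j l)), ?_⟩⟩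
  rw [Category.assoc, tensorHom_comp_tensorHom, leg_w, hg]

/-- After composing with the legs, the four equations become consequences of the lifting property
and the comonoid axioms of `c.pt`. Their sources are presentable, so each holds after a further
transition. -/
theorem Stage.exists_isNext {j : J} (s : Stage c j) : ∃ t : Stage c s.tgt, s.IsNext t := by
  have := isFiltered_of_isCardinalFiltered J κ
  obtain ⟨t⟩ := Stage.nonempty (κ := κ) hc s.tgt
  have mono {X : V} {l m n : J} (a b : X ⟶ K.obj l) (v : l ⟶ m) (w : m ⟶ n)
      (h : a ≫ K.map v = b ≫ K.map v) : a ≫ K.map (v ≫ w) = b ≫ K.map (v ≫ w) := by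
    simp [reassoc_of% h]
  have mono₂ {X : V} {l m n : J} (a b : X ⟶ K.obj l ⊗ K.obj l) (v : l ⟶ m) (w : m ⟶ n)
      (h : a ≫ (K.map v ⊗ₘ K.map v) = b ≫ (K.map v ⊗ₘ K.map v)) :
      a ≫ (K.map (v ≫ w) ⊗ₘ K.map (v ≫ w)) = b ≫ (K.map (v ≫ w) ⊗ₘ K.map (v ≫ w)) := by
    rw [K.map_comp, ← tensorHom_comp_tensorHom, reassoc_of% h]
  have mono₃ {X : V} {l m n : J} (a b : X ⟶ K.obj l ⊗ K.obj l ⊗ K.obj l) (v : l ⟶ m) (w : m ⟶ n)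
      (h : a ≫ (K.map v ⊗ₘ K.map v ⊗ₘ K.map v) = b ≫ (K.map v ⊗ₘ K.map v ⊗ₘ K.map v)) :
      a ≫ (K.map (v ≫ w) ⊗ₘ K.map (v ≫ w) ⊗ₘ K.map (v ≫ w)) =
        b ≫ (K.map (v ≫ w) ⊗ₘ K.map (v ≫ w) ⊗ₘ K.map (v ≫ w)) := by
    rw [K.map_comp, ← tensorHom_comp_tensorHom, ← tensorHom_comp_tensorHom, reassoc_of% h]
  have h1 : ∃ m, ∃ v : t.tgt ⟶ m, (s.δ ≫ (K.map t.u ⊗ₘ K.map t.u)) ≫ (K.map v ⊗ₘ K.map v) =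
      (K.map s.u ≫ t.δ) ≫ (K.map v ⊗ₘ K.map v) := by
    refine exists_eq_tensor (κ := κ) hc _ _ ?_
    rw [Category.assoc, Category.assoc, tensorHom_comp_tensorHom, leg_w, s.w, t.w, leg_w_assoc]
  have h2 : ∃ m, ∃ v : t.tgt ⟶ m, (s.δ ≫ (t.δ ⊗ₘ K.map t.u) ≫ (α_ _ _ _).hom) ≫
        (K.map v ⊗ₘ K.map v ⊗ₘ K.map v) =
      (s.δ ≫ (K.map t.u ⊗ₘ t.δ)) ≫ (K.map v ⊗ₘ K.map v ⊗ₘ K.map v) := by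
    refine exists_eq_tensor_tensor (κ := κ) hc _ _ ?_
    rw [Category.assoc, Category.assoc, Category.assoc, ← associator_naturality,
      tensorHom_comp_tensorHom_assoc, tensorHom_comp_tensorHom, leg_w, t.w]
    have e1 := tensorHom_comp_tensorHom (leg c s.tgt) (leg c s.tgt) Δ[c.pt] (𝟙 _)
    have e2 := tensorHom_comp_tensorHom (leg c s.tgt) (leg c s.tgt) (𝟙 _) Δ[c.pt]
    rw [Category.comp_id] at e1 e2
    rw [← e1, ← e2, Category.assoc, reassoc_of% s.w, reassoc_of% s.w, id_tensorHom, tensorHom_id,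
      ComonObj.comul_assoc]
  have h3 : ∃ m, ∃ v : t.tgt ⟶ m,
      (s.δ ≫ (leg c s.tgt ≫ ε[c.pt] ⊗ₘ K.map t.u) ≫ (λ_ _).hom) ≫ K.map v =
      (K.map s.u ≫ K.map t.u) ≫ K.map v := by
    refine IsCardinalPresentable.exists_eq_of_isColimit' κ hc _ _ ?_
    change _ ≫ leg c t.tgt = _ ≫ leg c t.tgt
    rw [Category.assoc, Category.assoc, Category.assoc, leg_w, leg_w, ← leftUnitor_naturality,
      ← id_tensorHom, tensorHom_comp_tensorHom_assoc, leg_w, Category.comp_id]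
    have e1 := tensorHom_comp_tensorHom (leg c s.tgt) (leg c s.tgt) ε[c.pt] (𝟙 _)
    rw [Category.comp_id] at e1
    rw [← e1, Category.assoc, reassoc_of% s.w, tensorHom_id, ComonObj.counit_comul_assoc,
      Iso.inv_hom_id, Category.comp_id]
  have h4 : ∃ m, ∃ v : t.tgt ⟶ m,
      (s.δ ≫ (K.map t.u ⊗ₘ leg c s.tgt ≫ ε[c.pt]) ≫ (ρ_ _).hom) ≫ K.map v =
      (K.map s.u ≫ K.map t.u) ≫ K.map v := by
    refine IsCardinalPresentable.exists_eq_of_isColimit' κ hc _ _ ?_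
    change _ ≫ leg c t.tgt = _ ≫ leg c t.tgt
    rw [Category.assoc, Category.assoc, Category.assoc, leg_w, leg_w, ← rightUnitor_naturality,
      ← tensorHom_id, tensorHom_comp_tensorHom_assoc, leg_w, Category.comp_id]
    have e1 := tensorHom_comp_tensorHom (leg c s.tgt) (leg c s.tgt) (𝟙 _) ε[c.pt]
    rw [Category.comp_id] at e1
    rw [← e1, Category.assoc, reassoc_of% s.w, id_tensorHom, ComonObj.comul_counit_assoc,
      Iso.inv_hom_id, Category.comp_id]
  -- All four equations survive further transitions, so they can be achieved at one index.
  obtain ⟨m, v, ⟨h1, h2⟩, h3, h4⟩ := exists_common_of_isFiltered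
    (fun v w h => ⟨mono₂ _ _ v w h.1, mono₃ _ _ v w h.2⟩)
    (fun v w h => ⟨mono _ _ v w h.1, mono _ _ v w h.2⟩)
    (exists_common_of_isFiltered (mono₂ _ _) (mono₃ _ _) h1 h2)
    (exists_common_of_isFiltered (mono _ _) (mono _ _) h3 h4)
  refine ⟨t.extend v, ?_, ?_, ?_, ?_⟩
  · change s.δ ≫ (K.map (t.u ≫ v) ⊗ₘ K.map (t.u ≫ v)) = K.map s.u ≫ t.δ ≫ (K.map v ⊗ₘ K.map v)
    rw [K.map_comp, ← tensorHom_comp_tensorHom]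
    simpa using h1
  · change s.δ ≫ (t.δ ≫ (K.map v ⊗ₘ K.map v) ⊗ₘ K.map (t.u ≫ v)) ≫ (α_ _ _ _).hom =
      s.δ ≫ (K.map (t.u ≫ v) ⊗ₘ t.δ ≫ (K.map v ⊗ₘ K.map v))
    rw [K.map_comp, ← tensorHom_comp_tensorHom, ← tensorHom_comp_tensorHom, Category.assoc,
      associator_naturality]
    simpa using h2
  · change s.δ ≫ (leg c s.tgt ≫ ε[c.pt] ⊗ₘ K.map (t.u ≫ v)) ≫ (λ_ _).hom =
      K.map s.u ≫ K.map (t.u ≫ v)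
    have e := tensorHom_comp_tensorHom (leg c s.tgt ≫ ε[c.pt]) (K.map t.u) (𝟙 _) (K.map v)
    rw [Category.comp_id] at e
    rw [K.map_comp, ← e, Category.assoc, id_tensorHom, leftUnitor_naturality]
    simpa using h3
  · change s.δ ≫ (K.map (t.u ≫ v) ⊗ₘ leg c s.tgt ≫ ε[c.pt]) ≫ (ρ_ _).hom =
      K.map s.u ≫ K.map (t.u ≫ v)
    have e := tensorHom_comp_tensorHom (K.map t.u) (leg c s.tgt ≫ ε[c.pt]) (K.map v) (𝟙 _)
    rw [Category.comp_id] at e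
    rw [K.map_comp, ← e, Category.assoc, tensorHom_id, rightUnitor_naturality]
    simpa using h4

/-- Any lift of the comultiplication of `c.pt` to the diagram `K` extends to a comonoid over
`c.pt` with a `κ`-presentable underlying object. -/
theorem Stage.exists_comonObj [HasColimitsOfSize.{v, v} V] (hκ : Cardinal.aleph0 < κ) {j : J}
    (s : Stage c j) :
    ∃ (D : V) (_ : ComonObj D) (_ : IsCardinalPresentable D κ) (a : K.obj s.tgt ⟶ D)
      (p : D ⟶ c.pt), IsComonHom p ∧ a ≫ p = leg c s.tgt ∧
        (K.map s.u ≫ a) ≫ Δ[D] = s.δ ≫ (a ⊗ₘ a) := by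
  choose next hnext using fun (j : J) (s : Stage c j) => s.exists_isNext (κ := κ) hc
  let S : ℕ → Σ j, Stage c j := fun n => Nat.rec ⟨j, s⟩ (fun _ x => ⟨x.2.tgt, next _ x.2⟩) n
  let X : ℕ → V := fun n => K.obj (S n).1
  let f (n : ℕ) : X n ⟶ X (n + 1) := K.map (S n).2.u
  let δ (n : ℕ) : X n ⟶ X (n + 1) ⊗ X (n + 1) := (S n).2.δ
  have hS (n : ℕ) : (S n).2.IsNext (S (n + 1)).2 := hnext _ _
  have hf (n : ℕ) : f n ≫ leg c (S (n + 1)).1 = leg c (S n).1 := leg_w _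
  obtain ⟨L, i, hL, hi, hdesc, hext⟩ := exists_sequential_colimit κ hκ X f (fun _ => hK _)
  obtain ⟨_, hΔ, hε⟩ := exists_comonObj_sequential hi hdesc hext δ
    (fun n => leg c (S n).1 ≫ ε[c.pt]) (fun n => by rw [reassoc_of% (hf n)])
    (fun n => (hS n).coh) (fun n => (hS n).assoc)
    (fun n => by rw [← cancel_mono (λ_ _).hom]; simpa using (hS n).counit_left)
    (fun n => by rw [← cancel_mono (ρ_ _).hom]; simpa using (hS n).counit_right)
  obtain ⟨p, hp⟩ := hdesc c.pt (fun n => leg c (S n).1) hf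
  -- The map is `i 1`, not `i 0`: the lift `s.δ` lands in the tensor square of `K.obj s.tgt`, which
  -- is `X 1`.
  refine ⟨L, inferInstance, hL, i 1, p, ⟨?_, ?_⟩, hp 1, ?_⟩
  · exact hext _ _ _ fun n => by rw [reassoc_of% (hp n), hε]
  · refine hext _ _ _ fun n => ?_
    rw [reassoc_of% (hp n), reassoc_of% (hΔ n), tensorHom_comp_tensorHom, hp]
    exact (S n).2.w.symm
  · exact (congrArg (· ≫ Δ[L]) (hi 0)).trans (hΔ 0)

omit hK in
/-- A map from a `κ`-presentable comonoid which lifts a comonoid morphism becomes compatible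
with the lifts of the comultiplication. -/
theorem Stage.exists_extend_comul {j : J} (s : Stage c j) {D : V} [ComonObj D]
    [IsCardinalPresentable D κ] (g : D ⟶ K.obj j) [IsComonHom (g ≫ leg c j)] :
    ∃ (l : J) (v : s.tgt ⟶ l), g ≫ (s.extend v).δ =
      Δ[D] ≫ (g ≫ K.map (s.extend v).u ⊗ₘ g ≫ K.map (s.extend v).u) := by
  obtain ⟨l, v, h⟩ := exists_eq_tensor (κ := κ) hc (g ≫ s.δ)
    (Δ[D] ≫ (g ≫ K.map s.u ⊗ₘ g ≫ K.map s.u)) (by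
      have := IsComonHom.hom_comul (g ≫ leg c j)
      rw [Category.assoc, s.w, Category.assoc, tensorHom_comp_tensorHom, Category.assoc, leg_w,
        ← this, Category.assoc])
  refine ⟨l, v, ?_⟩
  change g ≫ s.δ ≫ (K.map v ⊗ₘ K.map v) = Δ[D] ≫ (g ≫ K.map (s.u ≫ v) ⊗ₘ g ≫ K.map (s.u ≫ v))
  simpa using h

end Stage

/-! ### Density of the presentable comonoids. -/

section Dense

variable {V : Type u} [Category.{v} V] [MonoidalCategory V]

variable (V) in
/-- The comonoids whose underlying object is `κ`-presentable. -/
def presentableComon (κ : Cardinal.{v}) [Fact κ.IsRegular] : ObjectProperty (Comon V) :=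
  fun D => IsCardinalPresentable D.X κ

variable [SymmetricCategory V] [MonoidalClosed V] {κ : Cardinal.{v}} [Fact κ.IsRegular]

section

variable {J : Type v} [SmallCategory J] {K : J ⥤ V} {c : Cocone K} [ComonObj c.pt]

omit [SymmetricCategory V] [MonoidalClosed V] in
theorem Stage.comul_extend {j : J} {s : Stage c j} {D : V} [ComonObj D]
    {g : D ⟶ K.obj j} (h : g ≫ s.δ = Δ[D] ≫ (g ≫ K.map s.u ⊗ₘ g ≫ K.map s.u)) {l : J}
    (v : s.tgt ⟶ l) : g ≫ (s.extend v).δ =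
      Δ[D] ≫ (g ≫ K.map (s.extend v).u ⊗ₘ g ≫ K.map (s.extend v).u) := by
  change g ≫ s.δ ≫ (K.map v ⊗ₘ K.map v) = Δ[D] ≫ (g ≫ K.map (s.u ≫ v) ⊗ₘ g ≫ K.map (s.u ≫ v))
  rw [reassoc_of% h]
  simp

omit [SymmetricCategory V] [MonoidalClosed V] in
-- Compatibility with counits can be tested over `c.pt`. For comultiplications, `h` and `ha`
-- together express both sides through `s.δ`.
theorem Stage.isComonHom {j : J} {s : Stage c j} {D D' : V} [ComonObj D] [ComonObj D']
    {g : D ⟶ K.obj j} [IsComonHom (g ≫ leg c j)]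
    (h : g ≫ s.δ = Δ[D] ≫ (g ≫ K.map s.u ⊗ₘ g ≫ K.map s.u)) {a : K.obj s.tgt ⟶ D'}
    {p : D' ⟶ c.pt} [IsComonHom p] (hp : a ≫ p = leg c s.tgt)
    (ha : (K.map s.u ≫ a) ≫ Δ[D'] = s.δ ≫ (a ⊗ₘ a)) : IsComonHom (g ≫ K.map s.u ≫ a) where
  hom_counit := by
    rw [← IsComonHom.hom_counit p, Category.assoc, Category.assoc, reassoc_of% hp, leg_w_assoc,
      ← Category.assoc, IsComonHom.hom_counit]
  hom_comul := by
    rw [Category.assoc, ha, reassoc_of% h]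
    simp

variable [IsCardinalFiltered J κ] (hc : IsColimit c) [hK : ∀ j, IsCardinalPresentable (K.obj j) κ]
  [HasColimitsOfSize.{v, v} V] (hκ : Cardinal.aleph0 < κ)

include hc hκ in
/-- Two morphisms from `κ`-presentable comonoids to `C` which agree on an object `X` can be
merged into a single one. -/
theorem exists_merge {D₁ D₂ X : V} [ComonObj D₁] [ComonObj D₂] [IsCardinalPresentable D₁ κ]
    [IsCardinalPresentable D₂ κ] [IsCardinalPresentable X κ] (q₁ : D₁ ⟶ c.pt) (q₂ : D₂ ⟶ c.pt)
    [IsComonHom q₁] [IsComonHom q₂] (a₁ : X ⟶ D₁) (a₂ : X ⟶ D₂) (ha : a₁ ≫ q₁ = a₂ ≫ q₂) :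
    ∃ (D : V) (_ : ComonObj D) (_ : IsCardinalPresentable D κ) (q : D ⟶ c.pt) (h₁ : D₁ ⟶ D)
      (h₂ : D₂ ⟶ D), IsComonHom q ∧ IsComonHom h₁ ∧ IsComonHom h₂ ∧ h₁ ≫ q = q₁ ∧ h₂ ≫ q = q₂ ∧
        a₁ ≫ h₁ = a₂ ≫ h₂ := by
  obtain ⟨j₁, g₁, hg₁⟩ := IsCardinalPresentable.exists_hom_of_isColimit κ hc q₁
  obtain ⟨j₂, g₂, hg₂⟩ := IsCardinalPresentable.exists_hom_of_isColimit κ hc q₂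
  change g₁ ≫ leg c j₁ = q₁ at hg₁
  change g₂ ≫ leg c j₂ = q₂ at hg₂
  obtain ⟨j, u₁, u₂, hu⟩ := IsCardinalPresentable.exists_eq_of_isColimit κ hc (a₁ ≫ g₁) (a₂ ≫ g₂)
    (by
      change _ ≫ leg c j₁ = _ ≫ leg c j₂
      rw [Category.assoc, Category.assoc, hg₁, hg₂, ha])
  have e₁ : (g₁ ≫ K.map u₁) ≫ leg c j = q₁ := by rw [Category.assoc, leg_w, hg₁]
  have e₂ : (g₂ ≫ K.map u₂) ≫ leg c j = q₂ := by rw [Category.assoc, leg_w, hg₂]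
  have : IsComonHom ((g₁ ≫ K.map u₁) ≫ leg c j) := by rw [e₁]; infer_instance
  have : IsComonHom ((g₂ ≫ K.map u₂) ≫ leg c j) := by rw [e₂]; infer_instance
  obtain ⟨s⟩ := Stage.nonempty (κ := κ) hc j
  obtain ⟨l, v, hv⟩ := s.exists_extend_comul (κ := κ) hc (g₁ ≫ K.map u₁)
  obtain ⟨m, w, hw₂⟩ := (s.extend v).exists_extend_comul (κ := κ) hc (g₂ ≫ K.map u₂)
  -- Extending the stage for the second map keeps the compatibility already obtained for the first.
  have hw₁ := Stage.comul_extend hv w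
  generalize (s.extend v).extend w = t at hw₁ hw₂
  obtain ⟨D, _, hD, a, p, _, hp, hΔ⟩ := t.exists_comonObj hc hκ
  refine ⟨D, inferInstance, hD, p, (g₁ ≫ K.map u₁) ≫ K.map t.u ≫ a,
    (g₂ ≫ K.map u₂) ≫ K.map t.u ≫ a, inferInstance, Stage.isComonHom hw₁ hp hΔ,
    Stage.isComonHom hw₂ hp hΔ, ?_, ?_, ?_⟩
  · rw [← e₁, Category.assoc _ (K.map t.u ≫ a) p, Category.assoc (K.map t.u), hp, leg_w]
  · rw [← e₂, Category.assoc _ (K.map t.u ≫ a) p, Category.assoc (K.map t.u), hp, leg_w]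
  · simp only [Category.assoc] at hu
    simp [reassoc_of% hu]

end

variable [IsCardinalLocallyPresentable V κ] (hκ : Cardinal.aleph0 < κ)

include hκ

/-- Compatible families of morphisms indexed by the `κ`-presentable comonoids over `C` come from
a unique morphism out of `C`. -/
theorem existsUnique_desc (C Z : Comon V)
    (φ : ∀ D : Comon V, presentableComon V κ D → (D ⟶ C) → (D ⟶ Z))
    (hφ : ∀ (D D' : Comon V) (hD : presentableComon V κ D) (hD' : presentableComon V κ D')
      (h : D' ⟶ D) (q : D ⟶ C), φ D' hD' (h ≫ q) = h ≫ φ D hD q) :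
    ∃! d : C ⟶ Z, ∀ (D : Comon V) (hD : presentableComon V κ D) (q : D ⟶ C), q ≫ d = φ D hD q := by
  obtain ⟨J, _, _, ⟨P⟩⟩ := (isCardinalFilteredGenerator_isCardinalPresentable V
    κ).exists_colimitsOfShape C.X
  have hK (j : J) : IsCardinalPresentable (P.diag.obj j) κ := P.prop_diag_obj j
  let c : Cocone P.diag := P.cocone
  have hc : IsColimit c := P.isColimit
  let : ComonObj c.pt := C.comon
  -- The value of `φ` on a map `X ⟶ C.X` does not depend on the presentable comonoid it factors
  -- through: merge the two factorisations.
  have agree {X : V} [IsCardinalPresentable X κ] (D₁ D₂ : Comon V) (hD₁ : presentableComon V κ D₁)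
      (hD₂ : presentableComon V κ D₂) (q₁ : D₁ ⟶ C) (q₂ : D₂ ⟶ C) (a₁ : X ⟶ D₁.X) (a₂ : X ⟶ D₂.X)
      (ha : a₁ ≫ q₁.hom = a₂ ≫ q₂.hom) :
      a₁ ≫ (φ D₁ hD₁ q₁).hom = a₂ ≫ (φ D₂ hD₂ q₂).hom := by
    have : IsCardinalPresentable D₁.X κ := hD₁
    have : IsCardinalPresentable D₂.X κ := hD₂
    obtain ⟨D, _, hD, q, h₁, h₂, _, _, _, e₁, e₂, e⟩ := exists_merge (c := c) hc hκ q₁.hom q₂.hom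
      a₁ a₂ ha
    let q' : Comon.mk D ⟶ C := ⟨q⟩
    let h₁' : D₁ ⟶ Comon.mk D := ⟨h₁⟩
    let h₂' : D₂ ⟶ Comon.mk D := ⟨h₂⟩
    obtain rfl : h₁' ≫ q' = q₁ := Comon.ext e₁
    obtain rfl : h₂' ≫ q' = q₂ := Comon.ext e₂
    rw [hφ (Comon.mk D) D₁ hD, hφ (Comon.mk D) D₂ hD]
    exact (reassoc_of% e) _
  have cover (j : J) : ∃ (D : Comon V) (_ : presentableComon V κ D) (q : D ⟶ C)
      (a : P.diag.obj j ⟶ D.X), a ≫ q.hom = leg c j := by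
    obtain ⟨s⟩ := Stage.nonempty (κ := κ) hc j
    obtain ⟨D, _, hD, a, p, _, hp, -⟩ := s.exists_comonObj hc hκ
    exact ⟨Comon.mk D, hD, ⟨p⟩, P.diag.map s.u ≫ a, by
      rw [Category.assoc]; exact (congrArg (_ ≫ ·) hp).trans (leg_w _)⟩
  choose D hD q a ha using cover
  let t : Cocone P.diag := ⟨Z.X, { 
    app j := a j ≫ (φ (D j) (hD j) (q j)).hom
    naturality i j f := by
      have := agree (D j) (D i) (hD j) (hD i) (q j) (q i) (P.diag.map f ≫ a j) (a i)
        (by rw [Category.assoc, ha, ha, leg_w])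
      rw [← Category.assoc, this]
      exact (Category.comp_id _).symm }⟩
  let d : C.X ⟶ Z.X := hc.desc t
  have hd (j : J) : leg c j ≫ d = a j ≫ (φ (D j) (hD j) (q j)).hom := hc.fac t j
  -- Since `E.X` is presentable, `r` factors through some `K j`, hence through `D j`; `agree`
  -- compares it with `r` itself.
  have hqd (E : Comon V) (hE : presentableComon V κ E) (r : E ⟶ C) :
      r.hom ≫ d = (φ E hE r).hom := by
    have : IsCardinalPresentable E.X κ := hE
    obtain ⟨j, g, hg⟩ := IsCardinalPresentable.exists_hom_of_isColimit κ hc r.hom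
    change g ≫ leg c j = r.hom at hg
    rw [← hg, Category.assoc, hd]
    refine (Category.assoc _ _ _).symm.trans ((agree (D j) E (hD j) hE (q j) r (g ≫ a j) (𝟙 _) ?_).trans
      (Category.id_comp _))
    rw [Category.assoc, ha, hg, Category.id_comp]
  have hext {Y : V} {x y : C.X ⟶ Y} (h : ∀ j, leg c j ≫ x = leg c j ≫ y) : x = y := hc.hom_ext h
  have : IsComonHom d :=
    { hom_counit := hext fun j => by
        rw [reassoc_of% (hd j), IsComonHom.hom_counit (φ _ _ _).hom, ← ha, Category.assoc,
          IsComonHom.hom_counit (q j).hom]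
      hom_comul := hext fun j => by
        rw [reassoc_of% (hd j), IsComonHom.hom_comul (φ _ _ _).hom, ← ha, Category.assoc,
          IsComonHom.hom_comul_assoc (q j).hom, ← hqd, tensorHom_comp_tensorHom] }
  refine ⟨⟨d⟩, fun E hE r => Comon.ext (hqd E hE r), fun d' hd' => Comon.ext (hext fun j => ?_)⟩
  change _ = leg c j ≫ d
  rw [hd, ← ha, Category.assoc, ← hd' (D j) (hD j) (q j)]
  rfl

theorem isDense_presentableComon_ι : (presentableComon V κ).ι.IsDense where
  isDenseAt C := by
    let arrow (D : Comon V) (hD : presentableComon V κ D) (q : D ⟶ C) :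
        CostructuredArrow (presentableComon V κ).ι C :=
      CostructuredArrow.mk (Y := (⟨D, hD⟩ : (presentableComon V κ).FullSubcategory)) q
    have key (s : Cocone (CostructuredArrow.proj (presentableComon V κ).ι C ⋙
        (presentableComon V κ).ι)) :=
      existsUnique_desc hκ C s.pt (fun D hD q => s.ι.app (arrow D hD q))
        (fun D D' hD hD' h q => by
          let f : arrow D' hD' (h ≫ q) ⟶ arrow D hD q :=
            CostructuredArrow.homMk (ObjectProperty.homMk h)
          exact (s.w f).symm)
    exact ⟨{
      desc s := (key s).choose
      fac s j := by
        exact (congrArg (· ≫ (key s).choose) (Category.id_comp j.hom)).trans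
          ((key s).choose_spec.1 j.left.obj j.left.property j.hom)
      uniq s m hm := (key s).choose_spec.2 m fun D hD q => by
        exact (congrArg (· ≫ m) (Category.id_comp q)).symm.trans (hm (arrow D hD q)) }⟩

end Dense

/-! ### Essential smallness of the presentable comonoids. -/

section Small

variable {V : Type u} [Category.{v} V] [MonoidalCategory V]

instance small_comonObj (X : V) : Small.{v} (ComonObj X) :=
  small_of_injective (β := (X ⟶ 𝟙_ V) × (X ⟶ X ⊗ X)) (f := fun c => (c.counit, c.comul)) (by
    rintro ⟨e, d, _, _, _⟩ ⟨e', d', _, _, _⟩ h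
    obtain ⟨rfl, rfl⟩ : e = e' ∧ d = d' := by simpa using h
    rfl)

/-- Transport of a comonoid structure along an isomorphism. -/
abbrev comonObjOfIso {X Y : V} [ComonObj X] (e : X ≅ Y) : ComonObj Y where
  counit := e.inv ≫ ε[X]
  comul := e.inv ≫ Δ[X] ≫ (e.hom ⊗ₘ e.hom)
  counit_comul := by
    have h := tensorHom_comp_tensorHom e.hom e.hom (e.inv ≫ ε[X]) (𝟙 Y)
    rw [tensorHom_id, Iso.hom_inv_id_assoc, Category.comp_id] at h
    rw [Category.assoc, Category.assoc, h]
    simp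
  comul_counit := by
    have h := tensorHom_comp_tensorHom e.hom e.hom (𝟙 Y) (e.inv ≫ ε[X])
    rw [id_tensorHom, Iso.hom_inv_id_assoc, Category.comp_id] at h
    rw [Category.assoc, Category.assoc, h]
    simp
  comul_assoc := by
    have h := tensorHom_comp_tensorHom e.hom e.hom (𝟙 Y) (e.inv ≫ Δ[X] ≫ (e.hom ⊗ₘ e.hom))
    have h' := tensorHom_comp_tensorHom e.hom e.hom (e.inv ≫ Δ[X] ≫ (e.hom ⊗ₘ e.hom)) (𝟙 Y)
    rw [id_tensorHom, Iso.hom_inv_id_assoc, Category.comp_id] at h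
    rw [tensorHom_id, Iso.hom_inv_id_assoc, Category.comp_id] at h'
    have e1 := tensorHom_comp_tensorHom (𝟙 X) Δ[X] e.hom (e.hom ⊗ₘ e.hom)
    have e2 := tensorHom_comp_tensorHom Δ[X] (𝟙 X) (e.hom ⊗ₘ e.hom) e.hom
    rw [Category.id_comp] at e1 e2
    rw [Category.assoc, Category.assoc, h, Category.assoc, Category.assoc, reassoc_of% h', ← e1,
      ← e2, id_tensorHom, tensorHom_id, Category.assoc, associator_naturality]
    simp

instance essentiallySmall_presentableComon (κ : Cardinal.{v}) [Fact κ.IsRegular]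
    [HasCardinalFilteredGenerator V κ] :
    ObjectProperty.EssentiallySmall.{v} (presentableComon V κ) := by
  refine .of_functor _ (Comon.forget V) (.of_le (Q := isCardinalPresentable V κ) ?_) fun Y => ?_
  · rintro _ ⟨D, hD, ⟨e⟩⟩
    have : IsCardinalPresentable ((Comon.forget V).obj D) κ := hD
    exact isCardinalPresentable_of_iso e κ
  · refine ⟨.ofObj (fun c : ComonObj Y => (Comon.mk Y : Comon V)), inferInstance, ?_⟩
    rintro D ⟨-, ⟨e⟩⟩
    let e' : D.X ≅ Y := e
    let := comonObjOfIso e'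
    exact ⟨Comon.mk Y,
      ObjectProperty.ofObj_apply (fun c : ComonObj Y => (Comon.mk Y : Comon V)) this,
      ⟨Comon.mkIso (N := Comon.mk Y) e' (Iso.hom_inv_id_assoc _ _)
      (Iso.hom_inv_id_assoc _ _)⟩⟩

end Small

/-! ### Colimits of comonoids. -/

section Colimits

variable {V : Type u} [Category.{v} V] [MonoidalCategory V]

/-- Comonoids in `V` are the opposite of monoids in `Vᵒᵖ`, and limits of monoids are created by the
forgetful functor. -/
instance hasColimitsOfShape_comon {J : Type*} [Category* J] [HasColimitsOfShape J V] :
    HasColimitsOfShape J (Comon V) :=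
  have : HasLimitsOfShape Jᵒᵖ Vᵒᵖ := hasLimitsOfShape_opposite_opposite_iff.2 inferInstance
  have : HasColimitsOfShape J (Mon Vᵒᵖ)ᵒᵖ := hasColimitsOfShape_opposite_iff.2 inferInstance
  Adjunction.hasColimitsOfShape_of_equivalence (Comon.Comon_EquivMon_OpOp V).functor

instance preservesColimitsOfShape_comon_forget {J : Type*} [Category* J]
    [HasColimitsOfShape J V] : PreservesColimitsOfShape J (Comon.forget V) :=
  have : HasLimitsOfShape Jᵒᵖ Vᵒᵖ := hasLimitsOfShape_opposite_opposite_iff.2 inferInstance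
  have : PreservesColimitsOfShape J (Mon.forget Vᵒᵖ).leftOp :=
    preservesColimitsOfShape_leftOp J (Mon.forget Vᵒᵖ)
  let e : Comon.forget V ≅ (Comon.Comon_EquivMon_OpOp V).functor ⋙ (Mon.forget Vᵒᵖ).leftOp :=
    Iso.refl _
  preservesColimitsOfShape_of_natIso e.symm

end Colimits

/-! ### The adjoint functor theorem for convolution. -/

section Existence

variable {V : Type u} [Category.{v} V] [MonoidalCategory V] [SymmetricCategory V]
  [MonoidalClosed V]

/-- The bijection between morphisms `Y ⟶ [X, B]` and `X ⟶ [Y, B]`. -/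
def ihomFlip (X Y B : V) : (Y ⟶ (ihom X).obj B) ≃ (X ⟶ (ihom Y).obj B) where
  toFun f := MonoidalClosed.curry ((β_ _ _).hom ≫ MonoidalClosed.uncurry f)
  invFun f := MonoidalClosed.curry ((β_ _ _).hom ≫ MonoidalClosed.uncurry f)
  left_inv f := by
    dsimp only
    rw [MonoidalClosed.uncurry_curry, SymmetricCategory.symmetry_assoc,
      MonoidalClosed.curry_uncurry]
  right_inv f := by
    dsimp only
    rw [MonoidalClosed.uncurry_curry, SymmetricCategory.symmetry_assoc,
      MonoidalClosed.curry_uncurry]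

theorem ihomFlip_comp {X Y Y' B : V} (g : Y' ⟶ Y) (f : Y ⟶ (ihom X).obj B) :
    ihomFlip X Y' B (g ≫ f) = ihomFlip X Y B f ≫ (MonoidalClosed.pre g).app B := by
  apply MonoidalClosed.uncurry_injective
  simp only [ihomFlip, Equiv.coe_fn_mk]
  rw [MonoidalClosed.uncurry_curry, MonoidalClosed.uncurry_natural_left,
    MonoidalClosed.uncurry_pre_app, MonoidalClosed.uncurry_curry,
    BraidedCategory.braiding_naturality_left_assoc]

/-- The contravariant functor `[-, B]` is self-adjoint on the right. -/
def internalHomFlipAdj (B : V) :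
    (MonoidalClosed.internalHom.flip.obj B).rightOp ⊣ MonoidalClosed.internalHom.flip.obj B :=
  Adjunction.mkOfHomEquiv
    { homEquiv X Y := (opEquiv (op ((ihom X).obj B)) Y).trans (ihomFlip X Y.unop B)
      homEquiv_naturality_left_symm f g := congrArg Quiver.Hom.op (ihomFlip_comp f g)
      homEquiv_naturality_right f g := ihomFlip_comp g.unop f.unop }

/-- The functor `[-, B] : Comon(V)ᵒᵖ ⥤ Mon(V)`. -/
abbrev convHomLeft (B : Mon V) : (Comon V)ᵒᵖ ⥤ Mon V :=
  Prod.sectL _ B ⋙ convHom V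

instance preservesLimitsOfShape_convHomLeft (B : Mon V) (J : Type v) [SmallCategory J]
    [HasColimitsOfSize.{v, v} V] : PreservesLimitsOfShape J (convHomLeft B) := by
  have : PreservesLimitsOfShape J (Comon.forget V).op := preservesLimitsOfShape_op J _
  have : PreservesLimitsOfShape J (MonoidalClosed.internalHom.flip.obj B.X) :=
    (internalHomFlipAdj B.X).rightAdjoint_preservesLimits.1
  let e : convHomLeft B ⋙ Mon.forget V ≅
      (Comon.forget V).op ⋙ MonoidalClosed.internalHom.flip.obj B.X :=
    NatIso.ofComponents (fun _ => Iso.refl _) (fun _ =>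
      (Category.comp_id _).trans ((congrArg (_ ≫ ·) ((ihom _).map_id _)).trans
        ((Category.comp_id _).trans (Category.id_comp _).symm)))
  have := preservesLimitsOfShape_of_natIso (J := J) e.symm
  exact preservesLimitsOfShape_of_reflects_of_preserves _ (Mon.forget V)

/-- One object suffices: the limit in `Cᵒᵖ`, over all arrows `A ⟶ R (i s)`, of the objects `i s`. As
`X` is a colimit of objects `i s`, any `A ⟶ R X` gives a family of such arrows, and the projections
of the limit assemble to the required factorisation. -/
theorem solutionSetCondition_of_isDense {C : Type u₁} [Category.{v} C] {D : Type u₂}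
    [Category.{v} D] (R : Cᵒᵖ ⥤ D) [HasColimitsOfSize.{v, v} C]
    [∀ (J : Type v) [SmallCategory J], PreservesLimitsOfShape J R] {S : Type v} [SmallCategory S]
    (i : S ⥤ C) [i.IsDense] : SolutionSetCondition.{v} R := by
  intro A
  let L : StructuredArrow A (i.op ⋙ R) ⥤ Cᵒᵖ := StructuredArrow.proj A (i.op ⋙ R) ⋙ i.op
  have hT := isLimitOfPreserves R (limit.isLimit L)
  let s : Cone (L ⋙ R) :=
    { pt := A
      π :=
        { app w := w.hom
          naturality w w' f := (Category.id_comp _).trans (StructuredArrow.w f).symm } }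
  refine ⟨PUnit, fun _ => limit L, fun _ => hT.lift s, fun X h => ⟨⟨⟩, ?_⟩⟩
  have hX := i.denseAt X.unop
  let W (f : CostructuredArrow i X.unop) : StructuredArrow A (i.op ⋙ R) :=
    StructuredArrow.mk (Y := op f.left) (h ≫ R.map f.hom.op)
  let t : Cocone (CostructuredArrow.proj i X.unop ⋙ i) :=
    ⟨(limit L).unop,
        { app f := (limit.π L (W f)).unop
          naturality f g φ := by
            let ψ : W g ⟶ W f := StructuredArrow.homMk φ.left.op (by
              simp [W, ← R.map_comp, ← op_comp])
            have := limit.w L ψ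
            exact (congrArg Quiver.Hom.unop this).trans (Category.comp_id _).symm }⟩
  refine ⟨(hX.desc t).op, (isLimitOfPreserves R hX.op).hom_ext fun f => ?_⟩
  have h1 : (hX.desc t).op ≫ f.unop.hom.op = limit.π L (W f.unop) := by
    have := hX.fac t f.unop
    have h3 := congrArg (· ≫ hX.desc t) (Category.id_comp f.unop.hom)
    exact congrArg Quiver.Hom.op (h3.symm.trans this)
  have h2 : hT.lift s ≫ R.map (limit.π L (W f.unop)) = h ≫ R.map f.unop.hom.op :=
    hT.fac s (W f.unop)
  -- The legs of the canonical cocone are `f.hom` preceded by an identity, hence the arbitrary `q`.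
  have h3 (q : i.obj f.unop.left ⟶ X.unop) (hq : q = f.unop.hom) :
      (hT.lift s ≫ R.map (hX.desc t).op) ≫ R.map q.op = h ≫ R.map q.op := by
    subst hq
    exact (Category.assoc _ _ _).trans ((congrArg (hT.lift s ≫ ·)
      ((R.map_comp _ _).symm.trans (congrArg R.map h1))).trans h2)
  exact h3 _ (Category.id_comp _)

variable (V) in
theorem isRightAdjoint_convHomLeft [IsLocallyPresentable.{v} V] (B : Mon V) :
    (convHomLeft B).IsRightAdjoint := by
  obtain ⟨κ₀, _, _⟩ := IsLocallyPresentable.exists_cardinal.{v} V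
  -- Raising `κ₀` to at least `ℵ₁` keeps `V` locally presentable and makes sequences `κ`-small.
  let κ : Cardinal.{v} := max κ₀ (Cardinal.aleph 1)
  have : Fact κ.IsRegular := ⟨by
    change (max κ₀ (Cardinal.aleph 1)).IsRegular
    rcases max_choice κ₀ (Cardinal.aleph 1) with h | h
    · rw [h]; exact Fact.out
    · rw [h]; exact Cardinal.isRegular_aleph_one⟩
  have : IsCardinalLocallyPresentable V κ := .of_le V (le_max_left κ₀ _)
  have hκ : Cardinal.aleph0 < κ := Cardinal.aleph0_lt_aleph_one.trans_le (le_max_right _ _)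
  have := isDense_presentableComon_ι (V := V) hκ
  let i := (equivSmallModel.{v} (presentableComon V κ).FullSubcategory).inverse ⋙
    (presentableComon V κ).ι
  have : HasColimitsOfSize.{v, v} (Comon V) := ⟨fun _ _ => inferInstance⟩
  have : PreservesLimitsOfSize.{v, v} (convHomLeft B) := ⟨inferInstance⟩
  exact isRightAdjoint_of_preservesLimits_of_solutionSetCondition _
    (solutionSetCondition_of_isDense _ i)

end Existence

/-! ### Assembling pointwise representations into a Sweedler hom. -/

section Mk

variable {V : Type u} [Category.{v} V] [MonoidalCategory V] [SymmetricCategory V]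
  [MonoidalClosed V]

/-- A Sweedler hom from pointwise representations natural in the comonoid. -/
def SweedlerHom.mk' (Q : Mon V → Mon V → Comon V)
    (E : ∀ (A B : Mon V) (C : Comon V), (A ⟶ (convHom V).obj (op C, B)) ≃ (C ⟶ Q A B))
    (hE : ∀ (A B : Mon V) (C C' : Comon V) (c : C' ⟶ C) (f : A ⟶ (convHom V).obj (op C, B)),
      E A B C' (f ≫ (convHom V).map (c.op ×ₘ 𝟙 B)) = c ≫ E A B C f) : SweedlerHom V :=
  have hs {A B : Mon V} {C : Comon V} (g : C ⟶ Q A B) :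
      (E A B C).symm g = (E A B _).symm (𝟙 _) ≫ (convHom V).map (g.op ×ₘ 𝟙 B) := by
    rw [Equiv.symm_apply_eq, hE, Equiv.apply_symm_apply, Category.comp_id]
  have hs' {A B : Mon V} {C C' : Comon V} (c : C' ⟶ C) (g : C ⟶ Q A B) :
      (E A B C').symm (c ≫ g) = (E A B _).symm g ≫ (convHom V).map (c.op ×ₘ 𝟙 B) := by
    rw [Equiv.symm_apply_eq, hE, Equiv.apply_symm_apply]
  -- By Yoneda, the action of `P` on morphisms is forced by the universal element; this identity
  -- yields both functoriality and naturality.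
  have key {A A' B B' : Mon V} {C C' : Comon V} (a : A' ⟶ A) (b : B ⟶ B') (c : C' ⟶ C)
      (f : A ⟶ (convHom V).obj (op C, B)) :
      E A' B' C' (a ≫ f ≫ (convHom V).map (c.op ×ₘ b)) =
        c ≫ E A B C f ≫ E A' B' (Q A B) (a ≫ (E A B _).symm (𝟙 _) ≫
          (convHom V).map (𝟙 (op (Q A B)) ×ₘ b)) := by
    rw [← Equiv.eq_symm_apply, hs', hs', Equiv.symm_apply_apply]
    simp only [Category.assoc, ← Functor.map_comp, prod_comp]
    conv_lhs => rw [← (E A B C).symm_apply_apply f, hs]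
    simp [← Functor.map_comp]
  { P :=
      { obj X := Q X.1.unop X.2
        map {X Y} f := E _ _ _ (f.1.unop ≫ (E _ _ _).symm (𝟙 _) ≫
          (convHom V).map (𝟙 (op (Q X.1.unop X.2)) ×ₘ f.2))
        map_id X := by
          rw [← Equiv.eq_symm_apply]
          exact (Category.id_comp _).trans ((congrArg (_ ≫ ·) ((convHom V).map_id _)).trans
            (Category.comp_id _))
        map_comp {X Y Z} f g := by
          refine Eq.trans ?_ ((key g.1.unop g.2 (𝟙 _) (f.1.unop ≫ (E _ _ _).symm (𝟙 _) ≫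
            (convHom V).map (𝟙 (op (Q X.1.unop X.2)) ×ₘ f.2))).trans (Category.id_comp _))
          have e : (convHom V).map (𝟙 (op (Q X.1.unop X.2)) ×ₘ f.2) ≫
              (convHom V).map ((𝟙 (Q X.1.unop X.2)).op ×ₘ g.2) =
                (convHom V).map (𝟙 (op (Q X.1.unop X.2)) ×ₘ (f.2 ≫ g.2)) :=
            ((convHom V).map_comp _ _).symm.trans
              (congrArg _ (Prod.ext (Category.id_comp _) rfl))
          rw [Category.assoc, Category.assoc, e]
          exact congrArg _ (Category.assoc _ _ _) }
    homEquiv := E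
    homEquiv_naturality a b c f := key a b c f }

theorem SweedlerHom.nonempty [IsLocallyPresentable.{v} V] : Nonempty (SweedlerHom V) := by
  have (B : Mon V) := isRightAdjoint_convHomLeft V B
  exact ⟨SweedlerHom.mk' (fun A B => ((convHomLeft B).leftAdjoint.obj A).unop)
    (fun A B C => ((Adjunction.ofIsRightAdjoint (convHomLeft B)).homEquiv A (op C)).symm.trans
      (opEquiv _ _))
    (fun A B C C' c f => congrArg Quiver.Hom.unop
      ((Adjunction.ofIsRightAdjoint (convHomLeft B)).homEquiv_naturality_right_symm
        (Y := op C) f c.op))⟩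

end Mk

/-! ### Identities for the middle-four interchange. -/

section Coherence

variable {V : Type u} [Category.{v} V] [MonoidalCategory V] [SymmetricCategory V]

theorem tensorμ_braiding (X Y Z W : V) :
    tensorμ X Y Z W ≫ (β_ (X ⊗ Z) (Y ⊗ W)).hom =
      ((β_ X Y).hom ⊗ₘ (β_ Z W).hom) ≫ tensorμ Y X W Z := by
  simp [tensorμ, SymmetricCategory.braiding_swap_eq_inv_braiding Z Y, MonoidalCategory.tensorHom_def]

theorem tensorμ_tensorμ (X Y Z W : V) : tensorμ X Y Z W ≫ tensorμ X Z Y W = 𝟙 _ := by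
  rw [← tensorμ_tensorδ X Y Z W]
  simp [tensorμ, tensorδ, SymmetricCategory.braiding_swap_eq_inv_braiding]

/-- The tensor product functor of a symmetric monoidal category is lax braided. -/
abbrev tensorLaxBraided : (tensor V).LaxBraided where
  braided X Y := (braiding_tensorMu X.1 X.2 Y.1 Y.2).symm

/-- The tensor functor is lax braided with structure map `tensorμ`, and any lax braided functor
commutes with the interchange. -/
theorem tensorμ_interchange (W X Y Z W' X' Y' Z' : V) :
    tensorμ (W ⊗ W') (X ⊗ X') (Y ⊗ Y') (Z ⊗ Z') ≫
        (tensorμ W W' Y Y' ⊗ₘ tensorμ X X' Z Z') ≫ tensorμ (W ⊗ Y) (W' ⊗ Y') (X ⊗ Z) (X' ⊗ Z') =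
      (tensorμ W W' X X' ⊗ₘ tensorμ Y Y' Z Z') ≫ tensorμ (W ⊗ X) (W' ⊗ X') (Y ⊗ Z) (Y' ⊗ Z') ≫
        (tensorμ W X Y Z ⊗ₘ tensorμ W' X' Y' Z') := by
  let := tensorLaxBraided (V := V)
  exact tensorμ_comp_μ_tensorHom_μ_comp_μ (tensor V) (W, W') (X, X') (Y, Y') (Z, Z')

end Coherence

/-! ### Measurings and their tensor products. -/

section Measuring

variable {V : Type u} [Category.{v} V] [MonoidalCategory V] [SymmetricCategory V]

/-- A measuring `C ⊗ A ⟶ B` of monoids by a comonoid. -/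
structure IsMeasuring {C A B : V} [ComonObj C] [MonObj A] [MonObj B] (m : C ⊗ A ⟶ B) : Prop where
  one : C ◁ η[A] ≫ m = (ρ_ C).hom ≫ ε[C] ≫ η[B]
  mul : C ◁ μ[A] ≫ m = Δ[C] ▷ (A ⊗ A) ≫ tensorμ C C A A ≫ (m ⊗ₘ m) ≫ μ[B]

theorem isMeasuring_unit [ComonObj (𝟙_ V)] (h : ε[𝟙_ V] = 𝟙 _) (h' : Δ[𝟙_ V] = (λ_ _).inv) :
    IsMeasuring (λ_ (𝟙_ V)).hom where
  one := by simp [h, unitors_equal]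
  mul := by
    have := tensor_left_unitality (𝟙_ V) (𝟙_ V)
    rw [h', ← reassoc_of% this]
    simp

theorem IsMeasuring.tensor {C A B C' A' B' : V} [ComonObj C] [MonObj A] [MonObj B] [ComonObj C']
    [MonObj A'] [MonObj B'] {m : C ⊗ A ⟶ B} {m' : C' ⊗ A' ⟶ B'} (h : IsMeasuring m)
    (h' : IsMeasuring m') : IsMeasuring (tensorμ C C' A A' ≫ (m ⊗ₘ m')) where
  one := by
    rw [MonObj.tensorObj.one_def, MonObj.tensorObj.one_def, MonoidalCategory.whiskerLeft_comp,
      Category.assoc, tensorμ_natural_right_assoc, tensorHom_comp_tensorHom, h.one, h'.one,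
      ← tensorHom_comp_tensorHom, ← tensorHom_comp_tensorHom, Comon.tensorObj_counit,
      ← tensor_right_unitality_assoc]
    simp
  mul := by
    rw [MonObj.tensorObj.mul_def, MonObj.tensorObj.mul_def, MonoidalCategory.whiskerLeft_comp,
      Category.assoc, tensorμ_natural_right_assoc, tensorHom_comp_tensorHom, h.mul, h'.mul,
      Comon.tensorObj_comul, ← tensorHom_comp_tensorHom, ← tensorHom_comp_tensorHom,
      ← tensorHom_comp_tensorHom, ← tensorHom_comp_tensorHom (tensorμ C C' A A'), comp_whiskerRight,
      Category.assoc, Category.assoc, tensorμ_natural_assoc]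
    have e := tensorμ_interchange C C A A C' C' A' A'
    rw [reassoc_of% e]
    -- The interchange in the comultiplication of `C ⊗ C'` cancels the one produced by `e`, being
    -- inverse to it by symmetry.
    have e' : tensorμ C C C' C' ▷ ((A ⊗ A') ⊗ A ⊗ A') ≫
        (tensorμ C C' C C' ⊗ₘ tensorμ A A' A A') = ((C ⊗ C) ⊗ C' ⊗ C') ◁ tensorμ A A' A A' := by
      rw [← tensorHom_id, tensorHom_comp_tensorHom, tensorμ_tensorμ, Category.id_comp,
        id_tensorHom]
    rw [reassoc_of% e', ← whisker_exchange_assoc, tensorμ_natural_left_assoc]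

variable [MonoidalClosed V]

/-- The two measuring axioms are the transposes of the two monoid morphism axioms for the
convolution structure. -/
theorem isMeasuring_uncurry {C A B : V} [ComonObj C] [MonObj A] [MonObj B]
    (f : A ⟶ (ihom C).obj B) : IsMeasuring (MonoidalClosed.uncurry f) ↔ IsMonHom f := by
  have e1 : η[A] ≫ f = η[(ihom C).obj B] ↔
      C ◁ η[A] ≫ MonoidalClosed.uncurry f = (ρ_ C).hom ≫ ε[C] ≫ η[B] := by
    rw [← MonoidalClosed.uncurry_injective.eq_iff, MonoidalClosed.uncurry_natural_left, conv_one,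
      uncurry_ihomEps_ihomMap]
  have e2 : μ[A] ≫ f = (f ⊗ₘ f) ≫ μ[(ihom C).obj B] ↔
      C ◁ μ[A] ≫ MonoidalClosed.uncurry f = Δ[C] ▷ (A ⊗ A) ≫ tensorμ C C A A ≫
        (MonoidalClosed.uncurry f ⊗ₘ MonoidalClosed.uncurry f) ≫ μ[B] := by
    rw [← MonoidalClosed.uncurry_injective.eq_iff, MonoidalClosed.uncurry_natural_left, conv_mul,
      uncurry_ihomMu_ihomMap]
  exact ⟨fun h => ⟨e1.2 h.one, e2.2 h.mul⟩, fun h => ⟨e1.1 h.one_hom, e2.1 h.mul_hom⟩⟩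

namespace SweedlerHom

variable (S : SweedlerHom V)

/-- The measuring `C ⊗ A ⟶ B` associated to a morphism `C ⟶ P(A, B)`. -/
def meas {A B : Mon V} {C : Comon V} (g : C ⟶ S.P.obj (op A, B)) : C.X ⊗ A.X ⟶ B.X :=
  MonoidalClosed.uncurry ((S.homEquiv A B C).symm g).hom

theorem meas_injective {A B : Mon V} {C : Comon V} {g g' : C ⟶ S.P.obj (op A, B)}
    (h : S.meas g = S.meas g') : g = g' :=
  (S.homEquiv A B C).symm.injective (Mon.Hom.ext' (MonoidalClosed.uncurry_injective h))

theorem isMeasuring_meas {A B : Mon V} {C : Comon V} (g : C ⟶ S.P.obj (op A, B)) :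
    IsMeasuring (S.meas g) :=
  (isMeasuring_uncurry _).2 ((S.homEquiv A B C).symm g).isMonHom_hom

/-- The morphism `C ⟶ P(A, B)` associated to a measuring `C ⊗ A ⟶ B`. -/
def ofMeas {A B : Mon V} {C : Comon V} (m : C.X ⊗ A.X ⟶ B.X) (hm : IsMeasuring m) :
    C ⟶ S.P.obj (op A, B) :=
  S.homEquiv A B C
    { hom := MonoidalClosed.curry m
      isMonHom_hom := (isMeasuring_uncurry (C := C.X) (B := B.X) _).1
        ((MonoidalClosed.uncurry_curry m).symm ▸ hm) }

@[simp]
theorem meas_ofMeas {A B : Mon V} {C : Comon V} (m : C.X ⊗ A.X ⟶ B.X) (hm : IsMeasuring m) :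
    S.meas (S.ofMeas m hm) = m := by
  rw [meas, ofMeas, Equiv.symm_apply_apply]
  exact MonoidalClosed.uncurry_curry m

theorem meas_comp_map {A A' B B' : Mon V} {C C' : Comon V} (c : C' ⟶ C)
    (g : C ⟶ S.P.obj (op A, B)) (a : A' ⟶ A) (b : B ⟶ B') :
    S.meas (c ≫ g ≫ S.P.map (a.op ×ₘ b)) =
      c.hom ▷ A'.X ≫ C.X ◁ a.hom ≫ S.meas g ≫ b.hom := by
  have h := S.homEquiv_naturality a b c ((S.homEquiv A B C).symm g)
  rw [Equiv.apply_symm_apply, ← Equiv.eq_symm_apply] at h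
  rw [meas, ← h, ← whisker_exchange_assoc]
  have e : (a ≫ (S.homEquiv A B C).symm g ≫ (convHom V).map (c.op ×ₘ b)).hom =
      a.hom ≫ ((S.homEquiv A B C).symm g).hom ≫ ihomMap c.hom b.hom := rfl
  rw [e, MonoidalClosed.uncurry_natural_left]
  exact congrArg (_ ≫ ·) (uncurry_ihomMap _ _ _)

theorem meas_comp {A B : Mon V} {C C' : Comon V} (c : C' ⟶ C) (g : C ⟶ S.P.obj (op A, B)) :
    S.meas (c ≫ g) = c.hom ▷ A.X ≫ S.meas g := by
  have h := S.meas_comp_map c g (𝟙 A) (𝟙 B)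
  have e : S.P.map ((𝟙 A : A ⟶ A).op ×ₘ 𝟙 B) = 𝟙 _ := S.P.map_id _
  rw [e, Category.comp_id] at h
  rw [h]
  simp

theorem meas_map {X Y : (Mon V)ᵒᵖ × Mon V} {C : Comon V} (g : C ⟶ S.P.obj X) (f : X ⟶ Y) :
    S.meas (A := Y.1.unop) (B := Y.2) (g ≫ S.P.map f) =
      C.X ◁ f.1.unop.hom ≫ S.meas (A := X.1.unop) (B := X.2) g ≫ f.2.hom := by
  have h := S.meas_comp_map (𝟙 C) g f.1.unop f.2
  rw [Category.id_comp] at h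
  refine h.trans ?_
  simp

theorem meas_id (A B : Mon V) :
    S.meas (𝟙 (S.P.obj (op A, B))) = MonoidalClosed.uncurry (S.univ A B).hom := rfl

end SweedlerHom

end Measuring

/-! ### The lax monoidal structure: multiplication and associativity. -/

section

variable {V : Type u} [Category.{v} V] [MonoidalCategory V] [SymmetricCategory V]

theorem measuring_map {C C' A A' B B' H H' K K' : V} (m : C ⊗ A ⟶ B) (m' : C' ⊗ A' ⟶ B')
    (a : H ⟶ A) (a' : H' ⟶ A') (b : B ⟶ K) (b' : B' ⟶ K') :
    tensorμ C C' H H' ≫ (C ◁ a ≫ m ≫ b ⊗ₘ C' ◁ a' ≫ m' ≫ b') =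
      (C ⊗ C') ◁ (a ⊗ₘ a') ≫ (tensorμ C C' A A' ≫ (m ⊗ₘ m')) ≫ (b ⊗ₘ b') := by
  rw [← tensorHom_comp_tensorHom, ← tensorHom_comp_tensorHom, Category.assoc,
    tensorμ_natural_right_assoc]

theorem measuring_assoc {C C' C'' A A' A'' B B' B'' : V} (m : C ⊗ A ⟶ B) (m' : C' ⊗ A' ⟶ B')
    (m'' : C'' ⊗ A'' ⟶ B'') :
    ((C ⊗ C') ⊗ C'') ◁ (α_ A A' A'').inv ≫
        (tensorμ (C ⊗ C') C'' (A ⊗ A') A'' ≫ ((tensorμ C C' A A' ≫ (m ⊗ₘ m')) ⊗ₘ m'')) ≫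
          (α_ B B' B'').hom =
      (α_ C C' C'').hom ▷ (A ⊗ A' ⊗ A'') ≫ tensorμ C (C' ⊗ C'') A (A' ⊗ A'') ≫
        (m ⊗ₘ (tensorμ C' C'' A' A'' ≫ (m' ⊗ₘ m''))) := by
  have h := associator_monoidal C C' C'' A A' A''
  have h1 : ((tensorμ C C' A A' ≫ (m ⊗ₘ m')) ⊗ₘ m'') =
      tensorμ C C' A A' ▷ (C'' ⊗ A'') ≫ ((m ⊗ₘ m') ⊗ₘ m'') := by
    rw [← tensorHom_id, tensorHom_comp_tensorHom, Category.id_comp]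
  have h2 : (m ⊗ₘ (tensorμ C' C'' A' A'' ≫ (m' ⊗ₘ m''))) =
      (C ⊗ A) ◁ tensorμ C' C'' A' A'' ≫ (m ⊗ₘ (m' ⊗ₘ m'')) := by
    rw [← id_tensorHom, tensorHom_comp_tensorHom, Category.id_comp]
  rw [h1, h2, Category.assoc, Category.assoc, associator_naturality, reassoc_of% h,
    MonoidalCategory.tensorHom_def', Category.assoc, ← MonoidalCategory.whiskerLeft_comp_assoc,
    Iso.inv_hom_id, MonoidalCategory.whiskerLeft_id, Category.id_comp]

end

namespace SweedlerHom

variable {V : Type u} [Category.{v} V] [MonoidalCategory V] [SymmetricCategory V]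
  [MonoidalClosed V] (S : SweedlerHom V)

/-- The structure map `P(A, B) ⊗ P(A', B') ⟶ P(A ⊗ A', B ⊗ B')`. -/
def laxMu (X Y : (Mon V)ᵒᵖ × Mon V) : S.P.obj X ⊗ S.P.obj Y ⟶ S.P.obj (X ⊗ Y) :=
  S.ofMeas (A := X.1.unop ⊗ Y.1.unop) (B := X.2 ⊗ Y.2) (C := S.P.obj X ⊗ S.P.obj Y)
    (tensorμ (S.P.obj X).X (S.P.obj Y).X X.1.unop.X Y.1.unop.X ≫
      (S.meas (𝟙 (S.P.obj X)) ⊗ₘ S.meas (𝟙 (S.P.obj Y))))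
    ((S.isMeasuring_meas _).tensor (S.isMeasuring_meas _))

/-- The structure map `I ⟶ P(I, I)`. -/
def laxEps : 𝟙_ (Comon V) ⟶ S.P.obj (𝟙_ ((Mon V)ᵒᵖ × Mon V)) :=
  S.ofMeas (A := 𝟙_ (Mon V)) (B := 𝟙_ (Mon V)) (C := 𝟙_ (Comon V)) (λ_ (𝟙_ V)).hom
    (@isMeasuring_unit _ _ _ _ (𝟙_ (Comon V)).comon rfl rfl)

theorem meas_laxMu (X Y : (Mon V)ᵒᵖ × Mon V) :
    S.meas (A := X.1.unop ⊗ Y.1.unop) (B := X.2 ⊗ Y.2) (S.laxMu X Y) =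
    tensorμ (S.P.obj X).X (S.P.obj Y).X X.1.unop.X Y.1.unop.X ≫
      (S.meas (𝟙 (S.P.obj X)) ⊗ₘ S.meas (𝟙 (S.P.obj Y))) :=
  S.meas_ofMeas _ _

theorem meas_laxEps :
    S.meas (A := 𝟙_ (Mon V)) (B := 𝟙_ (Mon V)) S.laxEps = (λ_ (𝟙_ V)).hom :=
  S.meas_ofMeas _ _

theorem meas_eq {A B : Mon V} {C : Comon V} (g : C ⟶ S.P.obj (op A, B)) :
    S.meas g = g.hom ▷ A.X ≫ S.meas (𝟙 _) := by
  rw [← S.meas_comp, Category.comp_id]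

theorem meas_tensorHom_laxMu {X Y : (Mon V)ᵒᵖ × Mon V} {C D : Comon V} (g : C ⟶ S.P.obj X)
    (h : D ⟶ S.P.obj Y) :
    S.meas (A := X.1.unop ⊗ Y.1.unop) (B := X.2 ⊗ Y.2) ((g ⊗ₘ h) ≫ S.laxMu X Y) =
      tensorμ C.X D.X X.1.unop.X Y.1.unop.X ≫
        (S.meas (A := X.1.unop) (B := X.2) g ⊗ₘ S.meas (A := Y.1.unop) (B := Y.2) h) := by
  refine (S.meas_comp (A := X.1.unop ⊗ Y.1.unop) (B := X.2 ⊗ Y.2) _ _).trans ?_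
  rw [S.meas_laxMu, S.meas_eq (A := X.1.unop) (B := X.2) g,
    S.meas_eq (A := Y.1.unop) (B := Y.2) h, ← tensorHom_comp_tensorHom]
  exact tensorμ_natural_left_assoc _ _ _ _ _

theorem meas_whiskerRight_laxMu {X Y : (Mon V)ᵒᵖ × Mon V} {C : Comon V} (g : C ⟶ S.P.obj X) :
    S.meas (A := X.1.unop ⊗ Y.1.unop) (B := X.2 ⊗ Y.2) (g ▷ S.P.obj Y ≫ S.laxMu X Y) =
      tensorμ C.X (S.P.obj Y).X X.1.unop.X Y.1.unop.X ≫
        (S.meas (A := X.1.unop) (B := X.2) g ⊗ₘ S.meas (𝟙 (S.P.obj Y))) := by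
  rw [← tensorHom_id]
  exact S.meas_tensorHom_laxMu g (𝟙 _)

theorem meas_whiskerLeft_laxMu {X Y : (Mon V)ᵒᵖ × Mon V} {D : Comon V} (h : D ⟶ S.P.obj Y) :
    S.meas (A := X.1.unop ⊗ Y.1.unop) (B := X.2 ⊗ Y.2) (S.P.obj X ◁ h ≫ S.laxMu X Y) =
      tensorμ (S.P.obj X).X D.X X.1.unop.X Y.1.unop.X ≫
        (S.meas (𝟙 (S.P.obj X)) ⊗ₘ S.meas (A := Y.1.unop) (B := Y.2) h) := by
  rw [← id_tensorHom]
  exact S.meas_tensorHom_laxMu (𝟙 _) h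

theorem ext_meas {X : (Mon V)ᵒᵖ × Mon V} {C : Comon V} {g h : C ⟶ S.P.obj X}
    (e : S.meas (A := X.1.unop) (B := X.2) g = S.meas (A := X.1.unop) (B := X.2) h) : g = h :=
  S.meas_injective e

theorem laxMu_natural {X Y X' Y' : (Mon V)ᵒᵖ × Mon V} (f : X ⟶ Y) (g : X' ⟶ Y') :
    (S.P.map f ⊗ₘ S.P.map g) ≫ S.laxMu Y Y' = S.laxMu X X' ≫ S.P.map (f ⊗ₘ g) := by
  apply S.ext_meas
  refine (S.meas_tensorHom_laxMu _ _).trans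
    (Eq.trans ?_ (S.meas_map (S.laxMu X X') (f ⊗ₘ g)).symm)
  have h1 := S.meas_map (𝟙 (S.P.obj X)) f
  have h2 := S.meas_map (𝟙 (S.P.obj X')) g
  rw [Category.id_comp] at h1 h2
  rw [h1, h2]
  refine Eq.trans ?_ (congrArg (fun t => _ ≫ t ≫ _) (S.meas_laxMu X X').symm)
  exact measuring_map _ _ _ _ _ _

theorem laxMu_assoc (X Y Z : (Mon V)ᵒᵖ × Mon V) :
    S.laxMu X Y ▷ S.P.obj Z ≫ S.laxMu (X ⊗ Y) Z ≫ S.P.map (α_ X Y Z).hom =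
      (α_ (S.P.obj X) (S.P.obj Y) (S.P.obj Z)).hom ≫ S.P.obj X ◁ S.laxMu Y Z ≫
        S.laxMu X (Y ⊗ Z) := by
  have h1 := S.meas_map (S.laxMu X Y ▷ S.P.obj Z ≫ S.laxMu (X ⊗ Y) Z) (α_ X Y Z).hom
  have h2 := S.meas_whiskerRight_laxMu (Y := Z) (S.laxMu X Y)
  have h3 := S.meas_comp (A := X.1.unop ⊗ (Y.1.unop ⊗ Z.1.unop))
    (B := X.2 ⊗ (Y.2 ⊗ Z.2)) (α_ (S.P.obj X) (S.P.obj Y) (S.P.obj Z)).hom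
    (S.P.obj X ◁ S.laxMu Y Z ≫ S.laxMu X (Y ⊗ Z))
  have h4 := S.meas_whiskerLeft_laxMu (X := X) (S.laxMu Y Z)
  rw [comon_associator_hom] at h3
  rw [S.meas_laxMu] at h2 h4
  rw [Category.assoc] at h1
  apply S.ext_meas
  refine h1.trans (Eq.trans ?_ h3.symm)
  refine (congrArg (fun t => _ ≫ t ≫ _) h2).trans (Eq.trans ?_ (congrArg (fun t => _ ≫ t) h4.symm))
  exact measuring_assoc _ _ _

end SweedlerHom

/-! ### Unit laws, braiding, uniqueness and invertibility of the unit map. -/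

section

variable {V : Type u} [Category.{v} V] [MonoidalCategory V] [SymmetricCategory V]

theorem measuring_leftUnitor {C A B : V} (m : C ⊗ A ⟶ B) :
    (𝟙_ V ⊗ C) ◁ (λ_ A).inv ≫ (tensorμ (𝟙_ V) C (𝟙_ V) A ≫ ((λ_ (𝟙_ V)).hom ⊗ₘ m)) ≫
      (λ_ B).hom = (λ_ C).hom ▷ A ≫ m := by
  have h : ((λ_ (𝟙_ V)).hom ⊗ₘ m) = (λ_ (𝟙_ V)).hom ▷ (C ⊗ A) ≫ 𝟙_ V ◁ m :=
    MonoidalCategory.tensorHom_def _ _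
  have h1 := leftUnitor_monoidal C A
  rw [h, Category.assoc, Category.assoc, leftUnitor_naturality, ← reassoc_of% h1,
    MonoidalCategory.tensorHom_def', Category.assoc, ← MonoidalCategory.whiskerLeft_comp_assoc,
    Iso.inv_hom_id, MonoidalCategory.whiskerLeft_id, Category.id_comp]

theorem measuring_rightUnitor {C A B : V} (m : C ⊗ A ⟶ B) :
    (C ⊗ 𝟙_ V) ◁ (ρ_ A).inv ≫ (tensorμ C (𝟙_ V) A (𝟙_ V) ≫ (m ⊗ₘ (λ_ (𝟙_ V)).hom)) ≫
      (ρ_ B).hom = (ρ_ C).hom ▷ A ≫ m := by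
  have h : (m ⊗ₘ (λ_ (𝟙_ V)).hom) = (C ⊗ A) ◁ (λ_ (𝟙_ V)).hom ≫ m ▷ 𝟙_ V :=
    MonoidalCategory.tensorHom_def' _ _
  have h1 := rightUnitor_monoidal C A
  rw [h, Category.assoc, Category.assoc, rightUnitor_naturality, ← reassoc_of% h1,
    MonoidalCategory.tensorHom_def', Category.assoc, ← MonoidalCategory.whiskerLeft_comp_assoc,
    Iso.inv_hom_id, MonoidalCategory.whiskerLeft_id, Category.id_comp]

theorem measuring_braiding {C C' A A' B B' : V} (m : C ⊗ A ⟶ B) (m' : C' ⊗ A' ⟶ B') :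
    (C ⊗ C') ◁ (β_ A' A).hom ≫ (tensorμ C C' A A' ≫ (m ⊗ₘ m')) ≫ (β_ B B').hom =
      (β_ C C').hom ▷ (A' ⊗ A) ≫ tensorμ C' C A' A ≫ (m' ⊗ₘ m) := by
  have h := tensorμ_braiding C C' A A'
  rw [Category.assoc, BraidedCategory.braiding_naturality, reassoc_of% h,
    MonoidalCategory.tensorHom_def', Category.assoc, ← MonoidalCategory.whiskerLeft_comp_assoc,
    SymmetricCategory.symmetry, MonoidalCategory.whiskerLeft_id, Category.id_comp]

theorem comon_leftUnitor_hom (X : Comon V) : (λ_ X).hom.hom = (λ_ X.X).hom := by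
  simp only [Comon.monoidal_leftUnitor_hom_hom]
  change 𝟙 (𝟙_ V) ▷ X.X ≫ _ = _
  simp

theorem comon_rightUnitor_hom (X : Comon V) : (ρ_ X).hom.hom = (ρ_ X.X).hom := by
  simp only [Comon.monoidal_rightUnitor_hom_hom]
  change X.X ◁ 𝟙 (𝟙_ V) ≫ _ = _
  simp

end

namespace SweedlerHom

variable {V : Type u} [Category.{v} V] [MonoidalCategory V] [SymmetricCategory V]
  [MonoidalClosed V] (S : SweedlerHom V)

theorem laxMu_leftUnitor (X : (Mon V)ᵒᵖ × Mon V) :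
    (λ_ (S.P.obj X)).hom = S.laxEps ▷ S.P.obj X ≫ S.laxMu (𝟙_ _) X ≫ S.P.map (λ_ X).hom := by
  have h1 := S.meas_map (S.laxEps ▷ S.P.obj X ≫ S.laxMu (𝟙_ _) X) (λ_ X).hom
  have h2 := S.meas_whiskerRight_laxMu (Y := X) S.laxEps
  have h3 := S.meas_comp (A := X.1.unop) (B := X.2) (λ_ (S.P.obj X)).hom (𝟙 _)
  rw [Category.assoc] at h1
  rw [Category.comp_id, comon_leftUnitor_hom] at h3
  apply S.ext_meas
  refine h3.trans (Eq.trans ?_ h1.symm)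
  refine Eq.trans ?_ (congrArg (fun t => _ ≫ t ≫ _)
    (h2.trans (congrArg (fun t => _ ≫ (t ⊗ₘ _)) S.meas_laxEps)).symm)
  exact (measuring_leftUnitor _).symm

theorem laxMu_rightUnitor (X : (Mon V)ᵒᵖ × Mon V) :
    (ρ_ (S.P.obj X)).hom = S.P.obj X ◁ S.laxEps ≫ S.laxMu X (𝟙_ _) ≫ S.P.map (ρ_ X).hom := by
  have h1 := S.meas_map (S.P.obj X ◁ S.laxEps ≫ S.laxMu X (𝟙_ _)) (ρ_ X).hom
  have h2 := S.meas_whiskerLeft_laxMu (X := X) S.laxEps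
  have h3 := S.meas_comp (A := X.1.unop) (B := X.2) (ρ_ (S.P.obj X)).hom (𝟙 _)
  rw [Category.assoc] at h1
  rw [Category.comp_id, comon_rightUnitor_hom] at h3
  apply S.ext_meas
  refine h3.trans (Eq.trans ?_ h1.symm)
  refine Eq.trans ?_ (congrArg (fun t => _ ≫ t ≫ _)
    (h2.trans (congrArg (fun t => _ ≫ (_ ⊗ₘ t)) S.meas_laxEps)).symm)
  exact (measuring_rightUnitor _).symm

theorem laxMu_braiding (X Y : (Mon V)ᵒᵖ × Mon V) :
    S.laxMu X Y ≫ S.P.map (β_ X Y).hom = (β_ (S.P.obj X) (S.P.obj Y)).hom ≫ S.laxMu Y X := by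
  have h1 := S.meas_map (S.laxMu X Y) (β_ X Y).hom
  have h2 := S.meas_comp (A := Y.1.unop ⊗ X.1.unop) (B := Y.2 ⊗ X.2)
    (β_ (S.P.obj X) (S.P.obj Y)).hom (S.laxMu Y X)
  rw [S.meas_laxMu] at h2
  apply S.ext_meas
  refine h1.trans (Eq.trans ?_ h2.symm)
  refine (congrArg (fun t => _ ≫ t ≫ _) (S.meas_laxMu X Y)).trans ?_
  exact measuring_braiding _ _

/-- The lax monoidal structure on a Sweedler hom. -/
abbrev laxMonoidal : S.P.LaxMonoidal :=
  ⟨S.laxEps, S.laxMu, fun f X' => by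
    have h := S.laxMu_natural f (𝟙 X')
    rw [S.P.map_id] at h
    simpa using h, fun X' f => by
    have h := S.laxMu_natural (𝟙 X') f
    rw [S.P.map_id] at h
    simpa using h, S.laxMu_assoc, S.laxMu_leftUnitor, S.laxMu_rightUnitor⟩

/-- The lax braided structure on a Sweedler hom. -/
abbrev laxBraided : S.P.LaxBraided where
  toLaxMonoidal := S.laxMonoidal
  braided := S.laxMu_braiding

theorem meas_eq_univ {A B : Mon V} {C : Comon V} (g : C ⟶ S.P.obj (op A, B)) :
    S.meas g = MonoidalClosed.uncurry ((S.univ A B).hom ≫ ihomMap g.hom (𝟙 B.X)) := by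
  refine Eq.trans ?_ (uncurry_ihomMap (X := (S.P.obj (op A, B)).X) (Y := B.X)
    (S.univ A B).hom g.hom (𝟙 B.X)).symm
  rw [Category.comp_id, S.meas_eq, S.meas_id]

/-- Uncurried, the left side of the equation is the measuring of `m` and the right side is the
tensor product of the universal measurings, which defines `laxMu`. -/
theorem laxMu_iff {A B A' B' : Mon V}
    (m : S.P.obj (op A, B) ⊗ S.P.obj (op A', B') ⟶ S.P.obj (op (A ⊗ A'), B ⊗ B')) :
    (S.univ (A ⊗ A') (B ⊗ B')).hom ≫ ihomMap m.hom (𝟙 (B.X ⊗ B'.X)) =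
        ((S.univ A B).hom ⊗ₘ (S.univ A' B').hom) ≫
          ihomMu (S.P.obj (op A, B)).X B.X (S.P.obj (op A', B')).X B'.X ↔
      m = S.laxMu (op A, B) (op A', B') := by
  have h := (S.meas_laxMu (op A, B) (op A', B')).trans
    (uncurry_ihomMu (S.univ A B).hom (S.univ A' B').hom).symm
  have h' := S.meas_eq_univ m
  refine ⟨fun e => S.meas_injective ?_, fun e => MonoidalClosed.uncurry_injective ?_⟩
  · exact h'.trans ((congrArg MonoidalClosed.uncurry e).trans h.symm)
  · exact h'.symm.trans ((congrArg S.meas e).trans h)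

theorem laxEps_iff (e : 𝟙_ (Comon V) ⟶ S.P.obj (op (𝟙_ (Mon V)), 𝟙_ (Mon V))) :
    (S.univ (𝟙_ (Mon V)) (𝟙_ (Mon V))).hom ≫ ihomMap e.hom (𝟙 (𝟙_ V)) = ihomEps V ↔
      e = S.laxEps := by
  have h : S.meas (A := 𝟙_ (Mon V)) (B := 𝟙_ (Mon V)) S.laxEps =
      MonoidalClosed.uncurry (ihomEps V) :=
    S.meas_laxEps.trans (MonoidalClosed.uncurry_curry _).symm
  have h' := S.meas_eq_univ e
  refine ⟨fun e => S.meas_injective ?_, fun e => MonoidalClosed.uncurry_injective ?_⟩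
  · exact h'.trans ((congrArg MonoidalClosed.uncurry e).trans h.symm)
  · exact h'.symm.trans ((congrArg S.meas e).trans h)

theorem isInduced_laxMonoidal : S.IsInduced S.laxMonoidal :=
  ⟨fun _ _ _ _ => (S.laxMu_iff _).2 rfl, (S.laxEps_iff _).2 rfl⟩

theorem eq_laxMonoidal {L : S.P.LaxMonoidal} (h : S.IsInduced L) : L = S.laxMonoidal :=
  Functor.LaxMonoidal.ext ((S.laxEps_iff _).1 h.eps_univ)
    (funext fun _ => funext fun _ => (S.laxMu_iff _).1 (h.mu_univ _ _ _ _))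

theorem isIso_laxEps : IsIso S.laxEps := by
  let t (C : Comon V) : Unique (C ⟶ 𝟙_ (Comon V)) := Comon.uniqueHomToTrivial C
  let s (A : Mon V) : Unique (𝟙_ (Mon V) ⟶ A) := Mon.uniqueHomFromTrivial A
  -- The composite on `I` is the identity as `I` is terminal; the one on `P(I, I)` because its
  -- transpose starts at the initial monoid.
  refine ⟨(t _).default, (t _).instSubsingleton.elim _ _, S.meas_injective ?_⟩
  exact congrArg (fun f => MonoidalClosed.uncurry (Mon.Hom.hom f))
    ((s _).instSubsingleton.elim ((S.homEquiv (𝟙_ _) (𝟙_ _) _).symm _)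
      ((S.homEquiv (𝟙_ _) (𝟙_ _) _).symm _))

end SweedlerHom

end Sweedler

theorem mainTheorem6 (V : Type u) [Category.{v} V] [MonoidalCategory V] [SymmetricCategory V]
    [MonoidalClosed V] [IsLocallyPresentable.{v} V] :
    Nonempty (Sweedler.SweedlerHom V) ∧
    ∀ S : Sweedler.SweedlerHom V,
      ∃ L : S.P.LaxBraided,
        S.IsInduced L.toLaxMonoidal ∧
        IsIso L.ε ∧
        ∀ L' : S.P.LaxMonoidal, S.IsInduced L' → L' = L.toLaxMonoidal :=
  ⟨Sweedler.SweedlerHom.nonempty, fun S => ⟨S.laxBraided, S.isInduced_laxMonoidal,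
    S.isIso_laxEps, fun _ h => S.eq_laxMonoidal h⟩⟩
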